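/- Let $p\geq 1$, let $K=(k_1,\dots,k_p)$ with $k_i\in\mathbb{N}_{\geq 2}\cup\{\infty\}$, and let $K'=(k'_1,\dots,k'_p)$ with $k'_i\in\mathbb{N}_{\geq 1}$ and $k'_i\mid k_i$ for all $i$ (by convention, every nonzero integer divides $\infty$). Let $J(K)$ be the group with presentation $$J(K)=\langle s_1,\dots,s_p \mid s_1s_2\cdots s_p=s_2\cdots s_ps_1=\cdots=s_ps_1\cdots s_{p-1},\ \ s_i^{k_i}=1 \text{ if } k_i<\infty\rangle,$$ and let the generalized J-group $J\left(\begin{smallmatrix}K\\K'\end{smallmatrix}\right)$ be the normal closure of $\{s_1^{k'_1},\dots,s_p^{k'_p}\}$ in $J(K)$. Its reflections are the conjugates in $J(K)$ of those powers $(s_i^{k'_i})^n$ ($1\leq i\leq p$, $n\in\mathbb{Z}$) that are different from $1$. If $J\left(\begin{smallmatrix}K\\K'\end{smallmatrix}\right)$ is infinite, then its elements $x\neq 1$ of finite order are precisely its reflections of finite order. -/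

import Mathlib

namespace GenJ

/-- The word `s_{j+1} ⋯ s_p s_1 ⋯ s_j` in the free group on `s_1, …, s_p` (the generators are
indexed from `0`): the cyclic rotation by `j` places of the word `s_1 s_2 ⋯ s_p`. -/
def rotWord (p j : ℕ) : FreeGroup (Fin p) :=
  ((List.ofFn fun i : Fin p => FreeGroup.of i).rotate j).prod

/-- The relators of `J(K)`: those of the relations
`s_1 s_2 ⋯ s_p = s_2 ⋯ s_p s_1 = ⋯ = s_p s_1 ⋯ s_{p-1}`, and `s_i ^ k_i` for each `i` with
`k_i < ∞`. -/
def relators {p : ℕ} (K : Fin p → ℕ∞) : Set (FreeGroup (Fin p)) :=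
  {w | ∃ j : ℕ, j < p ∧ w = rotWord p 0 * (rotWord p j)⁻¹} ∪
    {w | ∃ (i : Fin p) (k : ℕ), K i = (k : ℕ∞) ∧ w = FreeGroup.of i ^ k}

/-- The generalized parent J-group `J(K)`. -/
abbrev ParentJ {p : ℕ} (K : Fin p → ℕ∞) : Type :=
  PresentedGroup (relators K)

/-- The generator `s_i` of `J(K)`. -/
def gen {p : ℕ} (K : Fin p → ℕ∞) (i : Fin p) : ParentJ K :=
  PresentedGroup.of i

/-- The generalized J-group with parameters `K`, `K'`: the normal closure in `J(K)` of
the elements `s_i ^ k'_i`. -/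
def generalizedJ {p : ℕ} (K : Fin p → ℕ∞) (K' : Fin p → ℕ) : Subgroup (ParentJ K) :=
  Subgroup.normalClosure (Set.range fun i => gen K i ^ K' i)

/-- The reflections of the generalized J-group with parameters `K`, `K'`: the conjugates in the
parent group `J(K)` of the nontrivial powers (those different from `1`) of the `s_i ^ k'_i`. -/
def reflections {p : ℕ} (K : Fin p → ℕ∞) (K' : Fin p → ℕ) : Set (ParentJ K) :=
  {x | ∃ (g : ParentJ K) (i : Fin p) (n : ℤ),
    (gen K i ^ K' i) ^ n ≠ 1 ∧ x = g * (gen K i ^ K' i) ^ n * g⁻¹}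

end GenJ

/-! Reflections are nontrivial elements of the normal closure by definition. Conversely, `J(K)`
contains the given infinite group, so it is infinite, and the main point (`exists_conj_gen_zpow`) is
that every torsion element of an infinite `J(K)` is conjugate to some `s_i ^ m`. If this element
lies in the normal closure, the character of `J(K)` counting `s_i` modulo `k'_i` kills it, hence
`k'_i ∣ m` and the element is a reflection (`dvd_of_gen_zpow_mem`).

For `p = 1, 2` the group is abelian. For `p ≥ 3`, the element `c = s_1 ⋯ s_p` is central, and
`J(K)/⟨c⟩` embeds as rotations in the Coxeter group `W` generated by reflections `r_i` in the sides
of a `p`-gon, via `s_i ↦ r_i r_{i+1}` (`toReflectionGroup_injective`). In an infinite Coxeter group,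
a torsion element is conjugate into a proper standard parabolic subgroup with finite exponents:
averaging a positive functional over the cyclic group gives an invariant functional, which can be
moved into the closed fundamental chamber (`exists_conj_mem_closure_of_isOfFinOrder`). For a polygon
such a subgroup involves at most two adjacent sides, so torsion in the quotient is conjugate to a
power of some `s_i` (`polygonGroup_torsion`).

A torsion element of `J(K)` is thus a conjugate of `s_i ^ m` times `c ^ l`, and `l = 0` once `c` has
infinite order. If some `k_i = ∞`, a character to `ℤ` shows this. Otherwise `J(K)` is made to act on
`X × ℝ` with `c` a nonzero vertical translation: `X = ℍ` in the hyperbolic case, and `X = ℂ` with a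
Heisenberg action in the Euclidean case. Spherical triangles do not occur: their `W` is finite
because its form is positive definite (`finite_of_cosForm_pos`), and then the transfer to the centre
makes `J(K)` finite (`finite_of_finite_polygonGroup`). -/

/-! ### Chebyshev values -/

/-- The sequence `0, 1, 2c, 4c² - 1, …` of values at `c` of the Chebyshev polynomials of the
second kind. -/
noncomputable def chebyshevSeq (c : ℝ) : ℕ → ℝ
  | 0 => 0
  | 1 => 1
  | k + 2 => 2 * c * chebyshevSeq c (k + 1) - chebyshevSeq c k

@[simp] lemma chebyshevSeq_zero (c : ℝ) : chebyshevSeq c 0 = 0 := rfl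

@[simp] lemma chebyshevSeq_one (c : ℝ) : chebyshevSeq c 1 = 1 := rfl

lemma chebyshevSeq_add_two (c : ℝ) (k : ℕ) :
    chebyshevSeq c (k + 2) = 2 * c * chebyshevSeq c (k + 1) - chebyshevSeq c k := rfl

lemma chebyshevSeq_cos_mul_sin (θ : ℝ) (k : ℕ) :
    chebyshevSeq (Real.cos θ) k * Real.sin θ = Real.sin (k * θ) := by
  induction k using Nat.twoStepInduction with
  | zero => simp
  | one => simp
  | more k ih1 ih2 =>
    have h1 : ((k + 2 : ℕ) : ℝ) * θ = ((k + 1 : ℕ) : ℝ) * θ + θ := by push_cast; ring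
    have h2 : (k : ℝ) * θ = ((k + 1 : ℕ) : ℝ) * θ - θ := by push_cast; ring
    rw [chebyshevSeq_add_two, sub_mul, mul_assoc, ih2, ih1, h1, h2, Real.sin_add, Real.sin_sub]
    ring

lemma chebyshevSeq_at_one (k : ℕ) : chebyshevSeq 1 k = k := by
  induction k using Nat.twoStepInduction with
  | zero => simp
  | one => simp
  | more k ih1 ih2 => rw [chebyshevSeq_add_two, ih1, ih2]; push_cast; ring

lemma sin_pi_div_pos {m : ℕ} (hm : 2 ≤ m) : 0 < Real.sin (Real.pi / m) := by
  have h2 : (2 : ℝ) ≤ m := by exact_mod_cast hm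
  apply Real.sin_pos_of_pos_of_lt_pi (by positivity)
  rw [div_lt_iff₀ (by linarith)]
  nlinarith [Real.pi_pos]

/-- The value is `sin (kπ/m) / sin (π/m)`. The case `m = 0` encodes an infinite exponent: then `π /
0 = 0`, the cosine is `1`, and the value is `k`. -/
lemma chebyshevSeq_cos_pi_div_nonneg {m k : ℕ} (h1 : m ≠ 1) (h : m = 0 ∨ k ≤ m) :
    0 ≤ chebyshevSeq (Real.cos (Real.pi / m)) k := by
  rcases Nat.eq_zero_or_pos m with rfl | hm
  · simp [chebyshevSeq_at_one]
  · have hk : k ≤ m := h.resolve_left hm.ne'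
    have hs := sin_pi_div_pos (show 2 ≤ m by omega)
    have hmR : (0 : ℝ) < m := by exact_mod_cast hm
    have hkR : (k : ℝ) ≤ m := by exact_mod_cast hk
    refine nonneg_of_mul_nonneg_left ?_ hs
    rw [chebyshevSeq_cos_mul_sin]
    apply Real.sin_nonneg_of_nonneg_of_le_pi (by positivity)
    rw [← mul_div_assoc, div_le_iff₀ hmR]
    nlinarith [Real.pi_pos]

/-! ### The geometric representation of a Coxeter matrix -/

namespace CoxeterMatrix

variable {B : Type*} [Fintype B] [DecidableEq B] (M : CoxeterMatrix B)

/-- The functional `v ↦ ⟨e_i, v⟩` for the form `⟨e_i, e_j⟩ = -cos (π / M i j)`. -/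
noncomputable def cosPairing (i : B) : (B → ℝ) →ₗ[ℝ] ℝ :=
  ∑ j, (-Real.cos (Real.pi / M i j)) • LinearMap.proj j

omit [DecidableEq B] in
lemma cosPairing_apply (i : B) (v : B → ℝ) :
    M.cosPairing i v = ∑ j, -Real.cos (Real.pi / M i j) * v j := by
  simp [cosPairing]

@[simp] lemma cosPairing_single (i j : B) :
    M.cosPairing i (Pi.single j 1) = -Real.cos (Real.pi / M i j) := by
  rw [cosPairing_apply, Finset.sum_eq_single j] <;> simp +contextual

lemma cosPairing_single_self (i : B) : M.cosPairing i (Pi.single i 1) = 1 := by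
  simp

/-- The reflection in `e_i` of the geometric representation. -/
noncomputable def reflectionEnd (i : B) : Module.End ℝ (B → ℝ) :=
  LinearMap.id - (2 • M.cosPairing i).smulRight (Pi.single i 1)

lemma reflectionEnd_apply (i : B) (v : B → ℝ) :
    M.reflectionEnd i v = v - (2 * M.cosPairing i v) • Pi.single i 1 := by
  simp [reflectionEnd]

lemma reflectionEnd_apply_of_ne {i j : B} (h : j ≠ i) (v : B → ℝ) :
    M.reflectionEnd i v j = v j := by
  simp [reflectionEnd_apply, h]

lemma reflectionEnd_single (i j : B) :
    M.reflectionEnd i (Pi.single j 1) =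
      Pi.single j 1 + (2 * Real.cos (Real.pi / M i j)) • Pi.single i 1 := by
  rw [reflectionEnd_apply, cosPairing_single]; module

lemma reflectionEnd_single_self (i : B) :
    M.reflectionEnd i (Pi.single i 1) = -Pi.single i 1 := by
  rw [reflectionEnd_apply, cosPairing_single_self]; module

lemma reflectionEnd_mul_self (i : B) : M.reflectionEnd i * M.reflectionEnd i = 1 := by
  ext1 x
  ext1
  simp only [LinearMap.comp_apply, LinearMap.single_apply, Module.End.mul_apply,
    Module.End.one_apply]
  rw [reflectionEnd_single, map_add, map_smul, reflectionEnd_single_self, reflectionEnd_single]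
  module

lemma reflectionEnd_mul_pow_single_left (i j : B) (n : ℕ) :
    ((M.reflectionEnd i * M.reflectionEnd j) ^ n) (Pi.single i 1) =
      chebyshevSeq (Real.cos (Real.pi / M i j)) (2 * n + 1) • Pi.single i 1 +
      chebyshevSeq (Real.cos (Real.pi / M i j)) (2 * n) • Pi.single j 1 := by
  induction n with
  | zero => simp
  | succ n ih =>
    rw [pow_succ', Module.End.mul_apply, ih, Module.End.mul_apply]
    simp only [map_add, map_smul, reflectionEnd_single_self, reflectionEnd_single, M.symmetric j i,
      map_neg]
    rw [show 2 * (n + 1) + 1 = (2 * n + 1) + 2 by ring, show 2 * (n + 1) = 2 * n + 2 by ring,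
      chebyshevSeq_add_two _ (2 * n + 1), show 2 * n + 1 + 1 = 2 * n + 2 by ring,
      chebyshevSeq_add_two]
    module

/-- The exponent is shifted to `n + 1` because exponent `0` would need the Chebyshev index `-1`. -/
lemma reflectionEnd_mul_pow_single_right (i j : B) (n : ℕ) :
    ((M.reflectionEnd i * M.reflectionEnd j) ^ (n + 1)) (Pi.single j 1) =
      -chebyshevSeq (Real.cos (Real.pi / M i j)) (2 * n + 2) • Pi.single i 1 -
      chebyshevSeq (Real.cos (Real.pi / M i j)) (2 * n + 1) • Pi.single j 1 := by
  induction n with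
  | zero =>
    simp [reflectionEnd_single_self, reflectionEnd_single, chebyshevSeq_add_two]
    module
  | succ n ih =>
    rw [pow_succ', Module.End.mul_apply, ih, Module.End.mul_apply]
    simp only [map_sub, map_add, map_smul, reflectionEnd_single_self, reflectionEnd_single,
      M.symmetric j i, map_neg]
    rw [show 2 * (n + 1) + 2 = (2 * n + 2) + 2 by ring, show 2 * (n + 1) + 1 = 2 * n + 1 + 2 by ring,
      chebyshevSeq_add_two _ (2 * n + 2), show 2 * n + 2 + 1 = 2 * n + 1 + 2 by ring,
      chebyshevSeq_add_two _ (2 * n + 1), show 2 * n + 1 + 1 = 2 * n + 2 by ring]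
    module

/-- For a finite exponent and `i ≠ j` the form is nondegenerate on the plane of `e_i, e_j`, so the
space splits into this plane and the common kernel of the two functionals. The product is the
identity on the kernel; on the plane, Chebyshev values at multiples of `π / m` give the order. -/
lemma reflectionEnd_isLiftable : M.IsLiftable M.reflectionEnd := by
  intro i j
  rcases eq_or_ne i j with rfl | hij
  · rw [M.diagonal, reflectionEnd_mul_self, one_pow]
  rcases Nat.eq_zero_or_pos (M i j) with h0 | hpos
  · rw [h0, pow_zero]
  have h2 : 2 ≤ M i j := by have := M.off_diagonal i j hij; omega
  have hs := sin_pi_div_pos h2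
  set θ := Real.pi / M i j with hθ
  have hmθ : (M i j : ℝ) * θ = Real.pi := by
    have : (M i j : ℝ) ≠ 0 := by exact_mod_cast hpos.ne'
    rw [hθ]; field_simp
  have hc : 1 - Real.cos θ ^ 2 ≠ 0 := by
    rw [← Real.sin_sq]; positivity
  have hi : ((M.reflectionEnd i * M.reflectionEnd j) ^ M i j) (Pi.single i 1) = Pi.single i 1 := by
    rw [reflectionEnd_mul_pow_single_left]
    have e1 : chebyshevSeq (Real.cos θ) (2 * M i j + 1) = 1 := by
      apply mul_right_cancel₀ hs.ne'
      rw [chebyshevSeq_cos_mul_sin, one_mul]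
      push_cast
      rw [show (2 * (M i j : ℝ) + 1) * θ = θ + 2 * (M i j * θ) by ring, hmθ, Real.sin_add_two_pi]
    have e2 : chebyshevSeq (Real.cos θ) (2 * M i j) = 0 := by
      apply mul_right_cancel₀ hs.ne'
      rw [chebyshevSeq_cos_mul_sin, zero_mul]
      push_cast
      rw [show (2 * (M i j : ℝ)) * θ = 2 * (M i j * θ) by ring, hmθ, Real.sin_two_pi]
    rw [e1, e2]; simp
  have hj : ((M.reflectionEnd i * M.reflectionEnd j) ^ M i j) (Pi.single j 1) = Pi.single j 1 := by
    obtain ⟨n, hn⟩ : ∃ n, M i j = n + 1 := ⟨M i j - 1, by omega⟩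
    have hnR : (M i j : ℝ) = n + 1 := by rw [hn]; push_cast; ring
    rw [hn, reflectionEnd_mul_pow_single_right]
    have e1 : chebyshevSeq (Real.cos θ) (2 * n + 1) = -1 := by
      apply mul_right_cancel₀ hs.ne'
      rw [chebyshevSeq_cos_mul_sin]
      push_cast
      rw [show (2 * (n : ℝ) + 1) * θ = -θ + 2 * (M i j * θ) by rw [hnR]; ring, hmθ,
        Real.sin_add_two_pi, Real.sin_neg]
      ring
    have e2 : chebyshevSeq (Real.cos θ) (2 * n + 2) = 0 := by
      apply mul_right_cancel₀ hs.ne'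
      rw [chebyshevSeq_cos_mul_sin, zero_mul]
      push_cast
      rw [show (2 * (n : ℝ) + 2) * θ = 2 * (M i j * θ) by rw [hnR]; ring, hmθ, Real.sin_two_pi]
    rw [e1, e2]; simp
  ext1 x
  ext1
  simp only [LinearMap.comp_apply, LinearMap.single_apply, Module.End.one_apply]
  set v : B → ℝ := Pi.single x 1
  set p := M.cosPairing i v
  set q := M.cosPairing j v
  -- The coefficients `a, b` solve the Gram system of `e_i, e_j`, so that `v'` is annihilated by
  -- both functionals.
  set a := (p + Real.cos θ * q) / (1 - Real.cos θ ^ 2)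
  set b := (q + Real.cos θ * p) / (1 - Real.cos θ ^ 2)
  have hji : M.cosPairing j (Pi.single i 1) = -Real.cos θ := by
    rw [cosPairing_single, M.symmetric j i]
  set v' := v - a • Pi.single i 1 - b • Pi.single j 1 with hv'
  have hv'i : M.cosPairing i v' = 0 := by
    simp only [hv', map_sub, map_smul, cosPairing_single_self, cosPairing_single, smul_eq_mul,
      ← hθ]
    change p - a * 1 - b * -Real.cos θ = 0
    simp only [a, b]; field_simp; ring
  have hv'j : M.cosPairing j v' = 0 := by
    simp only [hv', map_sub, map_smul, cosPairing_single_self, hji, smul_eq_mul]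
    change q - a * -Real.cos θ - b * 1 = 0
    simp only [a, b]; field_simp; ring
  have hfix : ∀ n : ℕ, ((M.reflectionEnd i * M.reflectionEnd j) ^ n) v' = v' := by
    intro n
    induction n with
    | zero => simp
    | succ n ih =>
      rw [pow_succ', Module.End.mul_apply, ih, Module.End.mul_apply, reflectionEnd_apply _ j,
        hv'j, mul_zero, zero_smul, sub_zero, reflectionEnd_apply, hv'i]
      simp
  have hdec : v = v' + a • Pi.single i 1 + b • Pi.single j 1 := by rw [hv']; module
  rw [hdec, map_add, map_add, map_smul, map_smul, hi, hj, hfix]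

end CoxeterMatrix

/-! ### Signs of roots and faithfulness -/

namespace CoxeterSystem

variable {B W : Type*} [Fintype B] [DecidableEq B] [Group W] {M : CoxeterMatrix B}
  (cs : CoxeterSystem M W)

/-- The geometric representation of a Coxeter group. -/
noncomputable def geomRep : W →* Module.End ℝ (B → ℝ) :=
  cs.lift ⟨M.reflectionEnd, M.reflectionEnd_isLiftable⟩

@[simp] lemma geomRep_simple (i : B) : cs.geomRep (cs.simple i) = M.reflectionEnd i :=
  cs.lift_apply_simple _ _

lemma geomRep_mul_apply (w w' : W) (v : B → ℝ) :
    cs.geomRep (w * w') v = cs.geomRep w (cs.geomRep w' v) := by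
  rw [map_mul, Module.End.mul_apply]

lemma geomRep_inv_apply (w : W) (v : B → ℝ) : cs.geomRep w⁻¹ (cs.geomRep w v) = v := by
  rw [← geomRep_mul_apply, inv_mul_cancel, map_one, Module.End.one_apply]

lemma geomRep_apply_inv (w : W) (v : B → ℝ) : cs.geomRep w (cs.geomRep w⁻¹ v) = v := by
  rw [← geomRep_mul_apply, mul_inv_cancel, map_one, Module.End.one_apply]

lemma geomRep_injective_apply (w : W) : Function.Injective (cs.geomRep w) :=
  Function.LeftInverse.injective (cs.geomRep_inv_apply w)

lemma geomRep_alternatingWord (i j : B) (k : ℕ) :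
    cs.geomRep (cs.wordProd (alternatingWord i j k)) (Pi.single i 1) =
      if Even k then
        chebyshevSeq (Real.cos (Real.pi / M i j)) (k + 1) • Pi.single i 1 +
          chebyshevSeq (Real.cos (Real.pi / M i j)) k • Pi.single j 1
      else
        chebyshevSeq (Real.cos (Real.pi / M i j)) k • Pi.single i 1 +
          chebyshevSeq (Real.cos (Real.pi / M i j)) (k + 1) • Pi.single j 1 := by
  induction k with
  | zero => simp [alternatingWord]
  | succ k ih =>
    rw [alternatingWord_succ', wordProd_cons, geomRep_mul_apply, ih, geomRep_simple,
      chebyshevSeq_add_two]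
    by_cases hk : Even k
    · have hk' : ¬ Even (k + 1) := by rwa [Nat.even_add_one, not_not]
      simp only [hk, hk', if_true, if_false, map_add, map_smul, M.reflectionEnd_single_self,
        M.reflectionEnd_single, M.symmetric j i]
      module
    · have hk' : Even (k + 1) := by rwa [Nat.even_add_one]
      simp only [hk, hk', if_true, if_false, map_add, map_smul, M.reflectionEnd_single_self,
        M.reflectionEnd_single]
      module

omit [Fintype B] [DecidableEq B] in
/-- Split off a longest alternating suffix of a reduced expression of `w`. -/
lemma exists_eq_mul_alternatingWord {w : W} {i j : B} (hj : cs.IsRightDescent w j)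
    (hi : ¬ cs.IsRightDescent w i) :
    ∃ v k, w = v * cs.wordProd (alternatingWord i j k) ∧ cs.length v < cs.length w ∧
      ¬ cs.IsRightDescent v i ∧ ¬ cs.IsRightDescent v j ∧ (M i j = 0 ∨ k + 1 ≤ M i j) := by
  classical
  let Q : ℕ → Prop := fun k => ∃ v, w = v * cs.wordProd (alternatingWord i j k) ∧
    cs.length w = cs.length v + k
  have hQ1 : Q 1 := by
    refine ⟨w * cs.simple j, ?_, ?_⟩
    · simp [alternatingWord]
    · rw [isRightDescent_iff] at hj; exact hj.symm
  have hQle : ∀ k, Q k → k ≤ cs.length w := by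
    rintro k ⟨v, -, h⟩; omega
  set k := Nat.findGreatest Q (cs.length w)
  have hQk : Q k := Nat.findGreatest_spec (hQle 1 hQ1) hQ1
  have hk1 : 1 ≤ k := Nat.le_findGreatest (hQle 1 hQ1) hQ1
  have hQk' : ¬ Q (k + 1) := fun h => by
    have := Nat.le_findGreatest (hQle _ h) h
    omega
  clear_value k
  obtain ⟨v, hv, hl⟩ := hQk
  -- Otherwise the next alternating letter could be moved from `v` to the suffix, against the
  -- maximality of `k`.
  have hx : ¬ cs.IsRightDescent v (if Even k then j else i) := by
    intro h
    apply hQk'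
    refine ⟨v * cs.simple (if Even k then j else i), ?_, ?_⟩
    · rw [alternatingWord_succ', wordProd_cons, mul_assoc, simple_mul_simple_cancel_left, hv]
    · rw [isRightDescent_iff] at h
      omega
  obtain ⟨k', rfl⟩ : ∃ k', k = k' + 1 := ⟨k - 1, by omega⟩
  -- Otherwise the end of `v` would cancel the first letter of the suffix and make `w` too short.
  have hy : ¬ cs.IsRightDescent v (if Even k' then j else i) := by
    intro h
    rw [isRightDescent_iff] at h
    rw [alternatingWord_succ', wordProd_cons, ← mul_assoc] at hv
    have h1 := cs.length_mul_le (v * cs.simple (if Even k' then j else i))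
      (cs.wordProd (alternatingWord i j k'))
    have h2 := cs.length_wordProd_le (alternatingWord i j k')
    rw [length_alternatingWord] at h2
    rw [← hv] at h1
    omega
  have hij : ¬ cs.IsRightDescent v i ∧ ¬ cs.IsRightDescent v j := by
    by_cases he : Even k'
    · rw [if_pos he] at hy
      rw [if_neg (by rwa [Nat.even_add_one, not_not])] at hx
      exact ⟨hx, hy⟩
    · rw [if_neg he] at hy
      rw [if_pos (by rwa [Nat.even_add_one])] at hx
      exact ⟨hy, hx⟩
  refine ⟨v, k' + 1, hv, by omega, hij.1, hij.2, ?_⟩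
  by_contra! hcon
  obtain ⟨hm0, hmk⟩ := hcon
  rcases (show M i j = k' + 1 ∨ M i j < k' + 1 by omega) with hm | hm
  -- With `k' + 1 = M i j` the braid relation rewrites the suffix so that it ends in `s_i`, which
  -- makes `i` a right descent of `w`.
  · apply hi
    have hb := cs.wordProd_braidWord_eq i j
    rw [braidWord, braidWord, M.symmetric j i, hm, alternatingWord_succ j i,
      wordProd_concat] at hb
    have hlen : w * cs.simple i = v * cs.wordProd (alternatingWord i j k') := by
      rw [hv, hb]; simp [mul_assoc]
    have h1 := cs.length_mul_le v (cs.wordProd (alternatingWord i j k'))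
    have h2 := cs.length_wordProd_le (alternatingWord i j k')
    rw [length_alternatingWord] at h2
    rw [IsRightDescent, hlen]
    omega
  · apply cs.not_isReduced_alternatingWord i j hm0 hm
    have h1 := cs.length_mul_le v (cs.wordProd (alternatingWord i j (k' + 1)))
    have h2 := cs.length_wordProd_le (alternatingWord i j (k' + 1))
    rw [length_alternatingWord] at h2
    rw [← hv] at h1
    rw [IsReduced, length_alternatingWord]
    omega

/-- Induction on length. Write `w = v u` with `u` an alternating word in `s_i, s_j`. Then `u e_i` is
a nonnegative combination of `e_i` and `e_j`, and the shorter `v`, having neither as a descent,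
sends both to nonnegative vectors. -/
theorem geomRep_single_nonneg {w : W} {i : B} (h : ¬ cs.IsRightDescent w i) :
    0 ≤ cs.geomRep w (Pi.single i 1) := by
  induction hn : cs.length w using Nat.strong_induction_on generalizing w i with
  | _ n ih =>
    subst hn
    by_cases hw : w = 1
    · subst hw
      rw [map_one, Module.End.one_apply]
      exact Pi.single_nonneg.mpr zero_le_one
    obtain ⟨j, hj⟩ := cs.exists_rightDescent_of_ne_one hw
    have hij : i ≠ j := by rintro rfl; exact h hj
    obtain ⟨v, k, hwv, hlt, hvi, hvj, hk⟩ := cs.exists_eq_mul_alternatingWord hj h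
    have h1 := ih _ hlt hvi rfl
    have h2 := ih _ hlt hvj rfl
    have hm1 := M.off_diagonal i j hij
    have a1 := chebyshevSeq_cos_pi_div_nonneg hm1 hk
    have a0 := chebyshevSeq_cos_pi_div_nonneg (k := k) hm1 (hk.imp_right (by omega))
    rw [hwv, geomRep_mul_apply, geomRep_alternatingWord]
    split_ifs <;> rw [map_add, map_smul, map_smul] <;>
      exact add_nonneg (smul_nonneg (by assumption) h1) (smul_nonneg (by assumption) h2)

theorem geomRep_single_nonpos {w : W} {i : B} (h : cs.IsRightDescent w i) :
    cs.geomRep w (Pi.single i 1) ≤ 0 := by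
  have h' : ¬ cs.IsRightDescent (w * cs.simple i) i := by
    rwa [isRightDescent_iff_not_isRightDescent_mul] at h
  have := cs.geomRep_single_nonneg h'
  rw [geomRep_mul_apply, geomRep_simple, M.reflectionEnd_single_self, map_neg] at this
  exact neg_nonneg.mp this

lemma geomRep_single_ne_zero (w : W) (i : B) : cs.geomRep w (Pi.single i 1) ≠ 0 := by
  intro h
  have := cs.geomRep_injective_apply w (h.trans (map_zero _).symm)
  have := congrFun this i
  simp at this

/-- Faithfulness: a nontrivial `w` has a right descent `i`, and it sends `e_i` to a nonpositive
vector. -/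
theorem eq_one_of_geomRep_single_eq {w : W}
    (h : ∀ i, cs.geomRep w (Pi.single i 1) = Pi.single i 1) : w = 1 := by
  by_contra hw
  obtain ⟨i, hi⟩ := cs.exists_rightDescent_of_ne_one hw
  have := cs.geomRep_single_nonpos hi i
  rw [h i] at this
  simp at this
  linarith

/-- The positive roots of the geometric representation. -/
def posRoots : Set (B → ℝ) := {α | 0 ≤ α ∧ ∃ w i, cs.geomRep w (Pi.single i 1) = α}

lemma geomRep_mem_posRoots {α : B → ℝ} (hα : α ∈ cs.posRoots) {w : W}
    (h : 0 ≤ cs.geomRep w α) : cs.geomRep w α ∈ cs.posRoots := by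
  obtain ⟨-, v, i, rfl⟩ := hα
  exact ⟨h, w * v, i, cs.geomRep_mul_apply _ _ _⟩

lemma geomRep_nonneg_or_nonpos {α : B → ℝ} (hα : α ∈ cs.posRoots) (w : W) :
    0 ≤ cs.geomRep w α ∨ cs.geomRep w α ≤ 0 := by
  obtain ⟨-, v, i, rfl⟩ := hα
  rw [← geomRep_mul_apply]
  by_cases h : cs.IsRightDescent (w * v) i
  · exact .inr (cs.geomRep_single_nonpos h)
  · exact .inl (cs.geomRep_single_nonneg h)

lemma single_mem_posRoots (i : B) : Pi.single i 1 ∈ cs.posRoots :=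
  ⟨Pi.single_nonneg.mpr zero_le_one, 1, i, by simp⟩

end CoxeterSystem

/-! ### The invariant form, inversions, and infinitude of roots -/

namespace CoxeterMatrix

variable {B : Type*} [Fintype B] [DecidableEq B] (M : CoxeterMatrix B)

/-- The quadratic form of the geometric representation. -/
noncomputable def cosForm (v : B → ℝ) : ℝ := ∑ i, v i * M.cosPairing i v

omit [DecidableEq B] in
lemma sum_mul_cosPairing_comm (u v : B → ℝ) :
    ∑ i, u i * M.cosPairing i v = ∑ i, v i * M.cosPairing i u := by
  simp only [cosPairing_apply, Finset.mul_sum]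
  rw [Finset.sum_comm]
  refine Finset.sum_congr rfl fun i _ => Finset.sum_congr rfl fun j _ => ?_
  rw [M.symmetric i j]; ring

lemma cosForm_reflectionEnd (i : B) (v : B → ℝ) :
    M.cosForm (M.reflectionEnd i v) = M.cosForm v := by
  have h1 : ∀ a : ℝ, ∀ u : B → ℝ,
      ∑ j, (v - a • (Pi.single i 1 : B → ℝ)) j * M.cosPairing j u =
        (∑ j, v j * M.cosPairing j u) - a * M.cosPairing i u := by
    intro a u
    simp [sub_mul, Finset.sum_sub_distrib, Pi.single_apply]
  rw [cosForm, reflectionEnd_apply, h1, sum_mul_cosPairing_comm, h1, map_sub, map_smul,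
    cosPairing_single_self, cosForm]
  simp only [smul_eq_mul]
  ring

lemma cosForm_smul_single (i : B) (a : ℝ) : M.cosForm (a • Pi.single i 1) = a ^ 2 := by
  simp [cosForm, Pi.single_apply]
  ring

end CoxeterMatrix

namespace CoxeterSystem

variable {B W : Type*} [Fintype B] [DecidableEq B] [Group W] {M : CoxeterMatrix B}
  (cs : CoxeterSystem M W)

lemma cosForm_geomRep (w : W) (v : B → ℝ) : M.cosForm (cs.geomRep w v) = M.cosForm v := by
  induction w using cs.simple_induction_left with
  | one => simp
  | mul_simple_left w i ih =>
    rw [geomRep_mul_apply, geomRep_simple, M.cosForm_reflectionEnd, ih]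

lemma cosForm_of_mem_posRoots {α : B → ℝ} (hα : α ∈ cs.posRoots) : M.cosForm α = 1 := by
  obtain ⟨-, w, i, rfl⟩ := hα
  simpa [cosForm_geomRep] using M.cosForm_smul_single i 1

/-- A simple reflection permutes the positive roots other than its own simple root. -/
lemma reflectionEnd_nonneg {α : B → ℝ} (hα : α ∈ cs.posRoots) {i : B} (h : α ≠ Pi.single i 1) :
    0 ≤ M.reflectionEnd i α := by
  rcases cs.geomRep_nonneg_or_nonpos hα (cs.simple i) with h1 | h1 <;> rw [geomRep_simple] at h1
  · exact h1
  · exfalso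
    -- The reflection changes only coordinate `i`, so a positive root that turns nonpositive is a
    -- multiple of `e_i`; form value `1` then makes it `e_i`.
    have hz : ∀ j, j ≠ i → α j = 0 := fun j hj =>
      le_antisymm (by simpa [M.reflectionEnd_apply_of_ne hj] using h1 j) (hα.1 j)
    have he : α = α i • Pi.single i 1 := by
      ext j
      rcases eq_or_ne j i with rfl | hj
      · simp
      · simp [hz j hj, hj]
    have hq := cs.cosForm_of_mem_posRoots hα
    rw [he, M.cosForm_smul_single] at hq
    have h0 : 0 ≤ α i := hα.1 i
    have : α i = 1 := by nlinarith
    rw [this, one_smul] at he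
    exact h he

/-- A further left factor `s_i` creates at most one new inversion, the root that `w` maps to `e_i`.
-/
lemma finite_inversions (w : W) : {α ∈ cs.posRoots | ¬ 0 ≤ cs.geomRep w α}.Finite := by
  induction w using cs.simple_induction_left with
  | one =>
    convert Set.finite_empty
    ext α
    simp only [map_one, Module.End.one_apply, Set.mem_ofPred_eq, Set.mem_empty_iff_false, iff_false]
    exact fun h => h.2 h.1.1
  | mul_simple_left w i ih =>
    refine (ih.insert (cs.geomRep w⁻¹ (Pi.single i 1))).subset ?_
    rintro α ⟨hα, hneg⟩
    by_cases h : 0 ≤ cs.geomRep w α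
    · left
      by_contra hne
      apply hneg
      rw [geomRep_mul_apply, geomRep_simple]
      refine cs.reflectionEnd_nonneg (cs.geomRep_mem_posRoots hα h) ?_
      intro he
      apply hne
      rw [← he, geomRep_inv_apply]
    · exact .inr ⟨hα, h⟩

/-- By faithfulness an element is determined by the images of the simple roots. These images are
roots, so finitely many roots would allow only finitely many elements. -/
lemma infinite_posRoots [Infinite W] : cs.posRoots.Infinite := by
  intro hfin
  let R : Set (B → ℝ) := cs.posRoots ∪ (fun α => -α) '' cs.posRoots
  have hR : R.Finite := hfin.union (hfin.image _)
  have hmem : ∀ w i, cs.geomRep w (Pi.single i 1) ∈ R := by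
    intro w i
    rcases cs.geomRep_nonneg_or_nonpos (cs.single_mem_posRoots i) w with h | h
    · exact .inl (cs.geomRep_mem_posRoots (cs.single_mem_posRoots i) h)
    · refine .inr ⟨-cs.geomRep w (Pi.single i 1), ⟨neg_nonneg.mpr h, w * cs.simple i, i, ?_⟩,
        neg_neg _⟩
      rw [geomRep_mul_apply, geomRep_simple, M.reflectionEnd_single_self, map_neg]
  have : Finite R := hR
  let f : W → B → R := fun w i => ⟨_, hmem w i⟩
  have hf : Function.Injective f := by
    intro w w' h
    have : w⁻¹ * w' = 1 := by
      apply cs.eq_one_of_geomRep_single_eq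
      intro i
      have hi := congrArg Subtype.val (congrFun h i)
      change cs.geomRep w _ = cs.geomRep w' _ at hi
      rw [geomRep_mul_apply, ← hi, geomRep_inv_apply]
    exact inv_mul_eq_one.mp this
  exact not_finite_iff_infinite.mpr ‹Infinite W› (Finite.of_injective f hf)

end CoxeterSystem

/-! ### Torsion in infinite Coxeter groups -/

namespace CoxeterSystem

variable {B W : Type*} [Fintype B] [DecidableEq B] [Group W] {M : CoxeterMatrix B}
  (cs : CoxeterSystem M W)

lemma map_reflectionEnd (M : CoxeterMatrix B) (y : (B → ℝ) →ₗ[ℝ] ℝ) (i : B) (v : B → ℝ) :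
    y (M.reflectionEnd i v) = y v - 2 * M.cosPairing i v * y (Pi.single i 1) := by
  rw [M.reflectionEnd_apply, map_sub, map_smul, smul_eq_mul]

lemma linearMap_nonneg {y : (B → ℝ) →ₗ[ℝ] ℝ} (hy : ∀ i, 0 ≤ y (Pi.single i 1)) {v : B → ℝ}
    (hv : 0 ≤ v) : 0 ≤ y v := by
  rw [LinearMap.pi_apply_eq_sum_univ y v]
  refine Finset.sum_nonneg fun i _ => smul_nonneg (hv i) ?_
  have h : (fun j => if i = j then (1 : ℝ) else 0) = Pi.single i 1 := by
    ext j
    simp [Pi.single_apply, eq_comm]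
  rw [h]
  exact hy i

lemma injective_reflectionEnd (M : CoxeterMatrix B) (i : B) :
    Function.Injective (M.reflectionEnd i) := by
  refine Function.LeftInverse.injective (g := M.reflectionEnd i) fun v => ?_
  rw [← Module.End.mul_apply, M.reflectionEnd_mul_self, Module.End.one_apply]

/-- A functional that is positive on almost all positive roots can be moved into the closed
fundamental chamber. -/
lemma exists_geomRep_dominant (y : (B → ℝ) →ₗ[ℝ] ℝ)
    (hy : {α ∈ cs.posRoots | y α ≤ 0}.Finite) :
    ∃ g : W, (∀ i, 0 ≤ y (cs.geomRep g (Pi.single i 1))) ∧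
      {α ∈ cs.posRoots | y (cs.geomRep g α) ≤ 0}.Finite := by
  -- The number of positive roots on which the functional is negative drops when a simple reflection
  -- with `y e_i < 0` is applied: `e_i` leaves the set and the other positive roots are permuted.
  induction hn : {α ∈ cs.posRoots | y α < 0}.ncard using Nat.strong_induction_on
    generalizing y with
  | _ n ih =>
    subst hn
    by_cases hdom : ∀ i, 0 ≤ y (Pi.single i 1)
    · exact ⟨1, by simpa using hdom, by simpa using hy⟩
    push Not at hdom
    obtain ⟨i, hi⟩ := hdom
    have hfin : {α ∈ cs.posRoots | y α < 0}.Finite :=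
      hy.subset fun α hα => ⟨hα.1, hα.2.le⟩
    set y' := y ∘ₗ M.reflectionEnd i with hy'
    have hyi : y' (Pi.single i 1) = -y (Pi.single i 1) := by
      rw [hy', LinearMap.comp_apply, M.reflectionEnd_single_self, map_neg]
    have key : ∀ α ∈ cs.posRoots, α ≠ Pi.single i 1 → M.reflectionEnd i α ∈ cs.posRoots := by
      intro α hα hne
      have := cs.geomRep_mem_posRoots (w := cs.simple i) hα
      rw [geomRep_simple] at this
      exact this (cs.reflectionEnd_nonneg hα hne)
    have hfin' : {α ∈ cs.posRoots | y' α ≤ 0}.Finite := by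
      refine ((hy.preimage (injective_reflectionEnd M i).injOn).insert (Pi.single i 1)).subset ?_
      rintro α ⟨hα, hle⟩
      by_cases hne : α = Pi.single i 1
      · exact .inl hne
      · exact .inr ⟨key α hα hne, hle⟩
    have hcard : {α ∈ cs.posRoots | y' α < 0}.ncard < {α ∈ cs.posRoots | y α < 0}.ncard := by
      have hmem : Pi.single i 1 ∈ {α ∈ cs.posRoots | y α < 0} := ⟨cs.single_mem_posRoots i, hi⟩
      rw [← Set.ncard_image_of_injective _ (injective_reflectionEnd M i)]
      apply Set.ncard_lt_ncard _ hfin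
      refine ⟨?_, fun hsub => ?_⟩
      · rintro _ ⟨α, ⟨hα, hlt⟩, rfl⟩
        refine ⟨key α hα ?_, hlt⟩
        rintro rfl
        linarith
      · obtain ⟨α, ⟨hα, -⟩, he⟩ := hsub hmem
        have h1 : α = -Pi.single i 1 := by
          apply injective_reflectionEnd M i
          rw [he, map_neg, M.reflectionEnd_single_self, neg_neg]
        have := hα.1 i
        rw [h1] at this
        simp at this
        linarith
    obtain ⟨g, hg1, hg2⟩ := ih _ hcard y' hfin' rfl
    refine ⟨cs.simple i * g, fun j => ?_, ?_⟩
    · simpa [geomRep_mul_apply, hy'] using hg1 j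
    · simpa [geomRep_mul_apply, hy'] using hg2

/-- The stabilizer of a functional in the closed fundamental chamber is generated by the simple
reflections fixing it. -/
lemma mem_closure_of_comp_geomRep_eq (y : (B → ℝ) →ₗ[ℝ] ℝ) (hy : ∀ i, 0 ≤ y (Pi.single i 1))
    (w : W) (hw : ∀ v, y (cs.geomRep w v) = y v) :
    w ∈ Subgroup.closure (cs.simple '' {i | y (Pi.single i 1) = 0}) := by
  induction hn : cs.length w using Nat.strong_induction_on generalizing w with
  | _ n ih =>
    subst hn
    by_cases h1 : w = 1
    · rw [h1]; exact one_mem _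
    obtain ⟨i, hi⟩ := cs.exists_rightDescent_of_ne_one h1
    -- At a descent, `w e_i ≤ 0`, so invariance gives `y e_i = y (w e_i) ≤ 0`.
    have h0 : y (Pi.single i 1) = 0 := by
      refine le_antisymm ?_ (hy i)
      have := linearMap_nonneg hy (neg_nonneg.mpr (cs.geomRep_single_nonpos hi))
      rw [map_neg, hw] at this
      linarith
    have hmem : cs.simple i ∈ Subgroup.closure (cs.simple '' {i | y (Pi.single i 1) = 0}) :=
      Subgroup.subset_closure ⟨i, h0, rfl⟩
    have := ih _ hi (w * cs.simple i) (fun v => by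
      rw [geomRep_mul_apply, hw, geomRep_simple, map_reflectionEnd, h0, mul_zero, sub_zero]) rfl
    simpa using mul_mem this hmem

/-- In an infinite Coxeter group every element of finite order is conjugate into a proper standard
parabolic subgroup all of whose Coxeter exponents are finite. -/
theorem exists_conj_mem_closure_of_isOfFinOrder [Infinite W] {w : W} (hw : IsOfFinOrder w) :
    ∃ (g : W) (I : Set B), I ≠ Set.univ ∧ (∀ i ∈ I, ∀ j ∈ I, M i j ≠ 0) ∧
      g⁻¹ * w * g ∈ Subgroup.closure (cs.simple '' I) := by
  obtain ⟨n, hn, hwn⟩ := isOfFinOrder_iff_pow_eq_one.mp hw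
  let x : (B → ℝ) →ₗ[ℝ] ℝ := ∑ j, LinearMap.proj j
  have hx : ∀ v, x v = ∑ j, v j := fun v => by simp [x]
  have hxpos : ∀ v : B → ℝ, 0 ≤ v → v ≠ 0 → 0 < x v := by
    intro v hv hne
    rw [hx]
    obtain ⟨j, hj⟩ := Function.ne_iff.mp hne
    exact Finset.sum_pos' (fun i _ => hv i) ⟨j, Finset.mem_univ j, lt_of_le_of_ne (hv j) hj.symm⟩
  -- The orbit sum of `x` is `w`-invariant. It is positive on every positive root that is not an
  -- inversion of some `w ^ k` with `k < n`, hence on all but finitely many.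
  let y : (B → ℝ) →ₗ[ℝ] ℝ := ∑ k ∈ Finset.range n, x ∘ₗ cs.geomRep (w ^ k)
  have hyv : ∀ v, y v = ∑ k ∈ Finset.range n, x (cs.geomRep (w ^ k) v) := fun v => by
    simp only [y, LinearMap.sum_apply, LinearMap.comp_apply]
  have hyw : ∀ v, y (cs.geomRep w v) = y v := by
    intro v
    rw [hyv, hyv]
    simp only [← geomRep_mul_apply, ← pow_succ]
    obtain ⟨m, rfl⟩ : ∃ m, n = m + 1 := ⟨n - 1, by omega⟩
    rw [Finset.sum_range_succ, Finset.sum_range_succ', hwn, pow_zero]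
  have hyfin : {α ∈ cs.posRoots | y α ≤ 0}.Finite := by
    refine (Set.Finite.biUnion (Finset.range n).finite_toSet
      (fun k _ => cs.finite_inversions (w ^ k))).subset ?_
    rintro α ⟨hα, hle⟩
    by_contra hcon
    simp only [Set.mem_iUnion, not_exists] at hcon
    have : 0 < y α := by
      rw [hyv]
      refine Finset.sum_pos (fun k hk => ?_) ⟨0, Finset.mem_range.mpr hn⟩
      refine hxpos _ ?_ ?_
      · by_contra hneg
        exact hcon k hk ⟨hα, hneg⟩
      · obtain ⟨-, v, i, rfl⟩ := hα
        rw [← geomRep_mul_apply]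
        exact cs.geomRep_single_ne_zero _ _
    linarith
  obtain ⟨g, hg1, hg2⟩ := cs.exists_geomRep_dominant y hyfin
  set z : (B → ℝ) →ₗ[ℝ] ℝ := y ∘ₗ cs.geomRep g with hz
  refine ⟨g, {i | z (Pi.single i 1) = 0}, ?_, ?_, ?_⟩
  · intro hI
    have hz0 : z = 0 := by
      ext i
      simpa using (Set.ext_iff.mp hI i).mpr trivial
    apply cs.infinite_posRoots
    refine hg2.subset fun α hα => ⟨hα, ?_⟩
    change z α ≤ 0
    rw [hz0]; simp
  · intro i hi j hj h0
    have hij : i ≠ j := by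
      rintro rfl
      rw [M.diagonal] at h0
      exact one_ne_zero h0
    -- With an infinite exponent the dihedral orbit of `e_i` contains infinitely many positive roots
    -- in the span of `e_i, e_j`, where `z` would vanish.
    let f : ℕ → B → ℝ := fun k => if Even k then
        ((k : ℝ) + 1) • Pi.single i 1 + (k : ℝ) • Pi.single j 1
      else (k : ℝ) • Pi.single i 1 + ((k : ℝ) + 1) • Pi.single j 1
    have hf : ∀ k, f k = cs.geomRep (cs.wordProd (alternatingWord i j k)) (Pi.single i 1) := by
      intro k
      rw [geomRep_alternatingWord, h0]
      simp [chebyshevSeq_at_one, f]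
    have hfi : Function.Injective f := by
      intro k l hkl
      have hs : ∀ k, x (f k) = 2 * k + 1 := by
        intro k
        have hxs : ∀ i, x (Pi.single i 1) = 1 := fun i => by simp [hx]
        simp only [f]
        split_ifs <;> simp only [map_add, map_smul, hxs, smul_eq_mul] <;> ring
      have := (hs k).symm.trans ((congrArg x hkl).trans (hs l))
      have h2 : (k : ℝ) = l := by linarith
      exact_mod_cast h2
    refine Set.infinite_of_injective_forall_mem hfi (fun k => ?_) hg2
    refine ⟨⟨?_, _, i, (hf k).symm⟩, ?_⟩
    · have hs : ∀ i : B, (0 : B → ℝ) ≤ Pi.single i 1 := fun i => Pi.single_nonneg.mpr zero_le_one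
      simp only [f]
      split_ifs <;> exact add_nonneg (smul_nonneg (by positivity) (hs _))
        (smul_nonneg (by positivity) (hs _))
    · change z (f k) ≤ 0
      have hi' : z (Pi.single i 1) = 0 := hi
      have hj' : z (Pi.single j 1) = 0 := hj
      simp only [f]
      split_ifs <;> simp [map_add, map_smul, hi', hj']
  · refine cs.mem_closure_of_comp_geomRep_eq z (fun i => hg1 i) _ fun v => ?_
    simp only [hz, LinearMap.comp_apply]
    rw [← geomRep_mul_apply, show g * (g⁻¹ * w * g) = w * g by group, geomRep_mul_apply, hyw]

end CoxeterSystem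

/-! ### The central element and the universal property of `J(K)` -/

lemma List.prod_rotate_of_commute {G : Type*} [Group G] {l : List G}
    (h : ∀ x ∈ l, Commute l.prod x) (j : ℕ) : (l.rotate j).prod = l.prod := by
  rw [List.rotate_eq_drop_append_take_mod]
  set m := j % l.length
  have h1 : (l.take m).prod * (l.drop m).prod = l.prod := by
    rw [← List.prod_append, List.take_append_drop]
  have h2 : Commute l.prod (l.take m).prod :=
    Commute.list_prod_right _ _ fun x hx => h x (List.mem_of_mem_take hx)
  rw [List.prod_append]
  apply mul_left_cancel (a := (l.take m).prod)
  rw [← mul_assoc, h1, h2.eq]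

lemma List.prod_ofFn_inv_mul_succ {G : Type*} [Group G] (p : ℕ) (g : ℕ → G) :
    (List.ofFn fun i : Fin p => (g i)⁻¹ * g (i + 1)).prod = (g 0)⁻¹ * g p := by
  induction p with
  | zero => simp
  | succ p ih =>
    rw [List.ofFn_succ_last, List.prod_append]
    simp only [Fin.val_castSucc, Fin.val_last, ih, List.prod_singleton]
    group

namespace GenJ

variable {p : ℕ} (K : Fin p → ℕ∞)

/-- The central element `s_1 ⋯ s_p` of `J(K)`. -/
def coxElt : ParentJ K := (List.ofFn (gen K)).prod

lemma mk_rotWord (j : ℕ) :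
    PresentedGroup.mk (relators K) (rotWord p j) = ((List.ofFn (gen K)).rotate j).prod := by
  rw [rotWord, map_list_prod, List.map_rotate, List.map_ofFn]
  rfl

lemma prod_rotate_gen {j : ℕ} (hj : j < p) :
    ((List.ofFn (gen K)).rotate j).prod = coxElt K := by
  have h : rotWord p 0 * (rotWord p j)⁻¹ ∈ relators K := .inl ⟨j, hj, rfl⟩
  have := PresentedGroup.mk_eq_mk_of_mul_inv_mem h
  rw [mk_rotWord, mk_rotWord, List.rotate_zero] at this
  exact this.symm

lemma gen_pow {i : Fin p} {k : ℕ} (h : K i = k) : gen K i ^ k = 1 := by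
  have h : FreeGroup.of i ^ k ∈ relators K := .inr ⟨i, k, h, rfl⟩
  have := PresentedGroup.one_of_mem h
  rwa [map_pow] at this

/-- Two successive rotations read `c = s_i t` and `c = t s_i` with the same `t`, so `c s_i = s_i t
s_i = s_i c`. -/
lemma coxElt_commute_gen (i : Fin p) : Commute (coxElt K) (gen K i) := by
  set l := List.ofFn (gen K) with hl
  have hlen : l.length = p := by simp [hl]
  have hi : (i : ℕ) < l.length := by rw [hlen]; exact i.2
  have h1 : (l.rotate i).prod = coxElt K := prod_rotate_gen K i.2
  have h2 : (l.rotate (i + 1)).prod = coxElt K := by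
    rcases Nat.lt_or_ge (i + 1) p with h | h
    · exact prod_rotate_gen K h
    · rw [show (i : ℕ) + 1 = l.length by omega, List.rotate_length]
      rfl
  rw [List.rotate_eq_drop_append_take hi.le, List.drop_eq_getElem_cons hi] at h1
  rw [List.rotate_eq_drop_append_take hi, List.take_succ_eq_append_getElem hi] at h2
  have hgi : l[(i : ℕ)] = gen K i := by simp [hl]
  rw [hgi] at h1 h2
  simp only [List.cons_append, List.prod_cons, List.prod_append, List.prod_nil, mul_one] at h1 h2
  change coxElt K * gen K i = gen K i * coxElt K
  nth_rw 1 [← h1]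
  rw [← h2]
  simp only [mul_assoc]

lemma closure_range_gen : Subgroup.closure (Set.range (gen K)) = ⊤ :=
  PresentedGroup.closure_range_of _

lemma coxElt_mem_center : coxElt K ∈ Subgroup.center (ParentJ K) := by
  rw [Subgroup.mem_center_iff]
  intro g
  have hg : g ∈ Subgroup.closure (Set.range (gen K)) := by
    rw [closure_range_gen]; trivial
  have hle : Subgroup.closure (Set.range (gen K)) ≤ Subgroup.centralizer {coxElt K} := by
    rw [Subgroup.closure_le]
    rintro _ ⟨i, rfl⟩
    simpa [Subgroup.mem_centralizer_singleton_iff] using (coxElt_commute_gen K i).symm.eq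
  simpa [Subgroup.mem_centralizer_singleton_iff] using hle hg

instance : (Subgroup.zpowers (coxElt K)).Normal :=
  ⟨fun n hn g => by
    have h := (Subgroup.mem_center_iff.mp
      (Subgroup.zpowers_le.mpr (coxElt_mem_center K) hn)) g
    rwa [h, mul_inv_cancel_right]⟩

lemma lift_relators_eq_one {G : Type*} [Group G] {f : Fin p → G}
    (hc : ∀ i, Commute (List.ofFn f).prod (f i))
    (hk : ∀ i (k : ℕ), K i = k → f i ^ k = 1) :
    ∀ r ∈ relators K, FreeGroup.lift f r = 1 := by
  have hrot : ∀ j, FreeGroup.lift f (rotWord p j) = (List.ofFn f).prod := by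
    intro j
    rw [rotWord, map_list_prod, List.map_rotate, List.map_ofFn, List.prod_rotate_of_commute]
    · congr 2
      ext i
      simp
    · intro x hx
      obtain ⟨i, rfl⟩ := List.mem_ofFn.mp hx
      have he : (⇑(FreeGroup.lift f) ∘ fun i => FreeGroup.of i) = f := by ext i; simp
      rw [he]
      exact hc i
  rintro r (⟨j, -, rfl⟩ | ⟨i, k, hKi, rfl⟩)
  · rw [map_mul, map_inv, hrot, hrot, mul_inv_cancel]
  · rw [map_pow, FreeGroup.lift_apply_of, hk i k hKi]

/-- The homomorphism from `J(K)` determined by the images of the generators. -/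
def lift {G : Type*} [Group G] (f : Fin p → G) (hc : ∀ i, Commute (List.ofFn f).prod (f i))
    (hk : ∀ i (k : ℕ), K i = k → f i ^ k = 1) : ParentJ K →* G :=
  PresentedGroup.toGroup (lift_relators_eq_one K hc hk)

section lift

variable {G : Type*} [Group G] (f : Fin p → G) (hc : ∀ i, Commute (List.ofFn f).prod (f i))
  (hk : ∀ i (k : ℕ), K i = k → f i ^ k = 1)

@[simp] lemma lift_gen (i : Fin p) : lift K f hc hk (gen K i) = f i :=
  PresentedGroup.toGroup.of _

@[simp] lemma lift_coxElt : lift K f hc hk (coxElt K) = (List.ofFn f).prod := by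
  rw [coxElt, map_list_prod, List.map_ofFn]
  congr 2
  ext i
  simp

end lift

/-- The polygon group: the quotient of `J(K)` by its central element. -/
abbrev PolygonGroup : Type := ParentJ K ⧸ Subgroup.zpowers (coxElt K)

/-- If `J(K)` has finite exponents and its polygon group is finite, then `J(K)` is finite: the
transfer homomorphism to the centre shows that the central element has finite order. -/
lemma finite_of_finite_polygonGroup (hK : ∀ i, K i ≠ ⊤) (hK0 : ∀ i, K i ≠ 0)
    [Finite (PolygonGroup K)] : Finite (ParentJ K) := by
  have hidx : (Subgroup.zpowers (coxElt K)).FiniteIndex :=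
    Subgroup.finiteIndex_of_finite_quotient
  have hcen : (Subgroup.center (ParentJ K)).FiniteIndex :=
    Subgroup.finiteIndex_of_le (Subgroup.zpowers_le.mpr (coxElt_mem_center K))
  -- `F` raises to the power of the index of the centre. It is a homomorphism to an abelian group,
  -- so torsion of the generators forces `F c`, a power of `c`, to be torsion.
  set F := MonoidHom.transferCenterPow (ParentJ K)
  have hF : ∀ i, IsOfFinOrder (F (gen K i)) := by
    intro i
    obtain ⟨k, hk⟩ := ENat.ne_top_iff_exists.mp (hK i)
    have hk0 : 0 < k := Nat.pos_of_ne_zero fun h => hK0 i (by rw [← hk, h]; rfl)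
    exact MonoidHom.isOfFinOrder F
      (isOfFinOrder_iff_pow_eq_one.mpr ⟨k, hk0, gen_pow K hk.symm⟩)
  have hlist : ∀ l : List (ParentJ K), (∀ x ∈ l, IsOfFinOrder (F x)) →
      IsOfFinOrder (F l.prod) := by
    intro l
    induction l with
    | nil => intro _; rw [List.prod_nil, map_one]; exact IsOfFinOrder.one
    | cons x l ih =>
      intro h
      rw [List.prod_cons, map_mul]
      refine Commute.isOfFinOrder_mul ?_ (h x (by simp)) (ih fun y hy => h y (by simp [hy]))
      exact Subtype.ext (Subgroup.mem_center_iff.mp (F l.prod).2 _)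
  have hc : IsOfFinOrder (coxElt K) := by
    have h1 : IsOfFinOrder (F (coxElt K)) := hlist _ fun x hx => by
      obtain ⟨i, rfl⟩ := List.mem_ofFn.mp hx
      exact hF i
    have h2 := MonoidHom.isOfFinOrder (Subgroup.center (ParentJ K)).subtype h1
    exact IsOfFinOrder.of_pow h2 hcen.index_ne_zero
  have : Finite (Subgroup.zpowers (coxElt K)) := finite_zpowers.mpr hc
  exact Finite.of_subgroup_quotient (Subgroup.zpowers (coxElt K))

end GenJ

/-! ### Dihedral subgroups -/

namespace CoxeterSystem

/-- If `M i j = ∞`, then `s_i s_j` has infinite order. -/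
lemma not_isOfFinOrder_simple_mul_simple {B W : Type*} [Fintype B] [Group W]
    {M : CoxeterMatrix B} (cs : CoxeterSystem M W) {i j : B} (hij : i ≠ j) (h : M i j = 0) :
    ¬ IsOfFinOrder (cs.simple i * cs.simple j) := by
  classical
  intro hfin
  obtain ⟨n, hn, hpow⟩ := isOfFinOrder_iff_pow_eq_one.mp hfin
  -- The `j`-coordinate of `(s_i s_j) ^ n e_i` is `2 n`.
  have h1 := congrArg (fun f => f (Pi.single i 1) j) (congrArg cs.geomRep hpow)
  simp [map_pow, M.reflectionEnd_mul_pow_single_left, h, chebyshevSeq_at_one, hij.symm] at h1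
  omega

/-- The elements of a subgroup generated by two involutions. -/
lemma _root_.Subgroup.mem_zpowers_or_of_mem_closure_pair {G : Type*} [Group G] {a b x : G}
    (ha : a * a = 1) (hb : b * b = 1) (hx : x ∈ Subgroup.closure {a, b}) :
    x ∈ Subgroup.zpowers (a * b) ∨ x * a ∈ Subgroup.zpowers (a * b) := by
  have key : ∀ x : G, (x ∈ Subgroup.zpowers (a * b) ∨ x * a ∈ Subgroup.zpowers (a * b)) →
      ∀ y ∈ ({a, b} : Set G),
        x * y ∈ Subgroup.zpowers (a * b) ∨ x * y * a ∈ Subgroup.zpowers (a * b) := by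
    have hab : a * b ∈ Subgroup.zpowers (a * b) := Subgroup.mem_zpowers _
    have hinv : b * a = (a * b)⁻¹ := by
      rw [mul_inv_rev, ← eq_inv_of_mul_eq_one_left ha, ← eq_inv_of_mul_eq_one_left hb]
    rintro x (hx | hx) y (rfl | rfl)
    · right; rwa [mul_assoc, ha, mul_one]
    · right; rw [mul_assoc, hinv]; exact mul_mem hx (inv_mem hab)
    · left; exact hx
    · left
      have := mul_mem hx hab
      rwa [mul_assoc, ← mul_assoc a a, ha, one_mul] at this
  induction hx using Subgroup.closure_induction_right with
  | one => exact .inl (one_mem _)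
  | mul_right x _ y hy ih => exact key x ih y hy
  | mul_inv_cancel x _ y hy ih =>
    have hyi : y⁻¹ = y := by
      rcases hy with rfl | rfl
      exacts [(eq_inv_of_mul_eq_one_left ha).symm, (eq_inv_of_mul_eq_one_left hb).symm]
    rw [hyi]
    exact key x ih y hy

lemma mem_zpowers_of_mem_closure_pair {B W : Type*} [Group W]
    {M : CoxeterMatrix B} (cs : CoxeterSystem M W) {i j : B} {w : W}
    (hw : w ∈ Subgroup.closure {cs.simple i, cs.simple j}) (hpar : cs.lengthParity w = 1) :
    w ∈ Subgroup.zpowers (cs.simple i * cs.simple j) := by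
  have h2 : ∀ i j, cs.lengthParity (cs.simple i * cs.simple j) = 1 := fun i j => by
    rw [map_mul, lengthParity_simple, lengthParity_simple]; rfl
  refine (Subgroup.mem_zpowers_or_of_mem_closure_pair (cs.simple_mul_simple_self i)
    (cs.simple_mul_simple_self j) hw).resolve_right ?_
  rintro ⟨n, hn⟩
  have h3 := congrArg cs.lengthParity hn
  simp only [map_zpow, h2, one_zpow, map_mul cs.lengthParity w, hpar, one_mul,
    lengthParity_simple] at h3
  exact absurd h3 (by decide)

end CoxeterSystem

/-! ### Polygon groups inside polygon reflection groups -/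

namespace GenJ

section prefixes

variable {p : ℕ} {G : Type*} [Group G] (f : Fin p → G)

/-- The product of the first `m` values of `f`. -/
def prefixProd (m : ℕ) : G := ((List.ofFn f).take m).prod

@[simp] lemma prefixProd_zero : prefixProd f 0 = 1 := by simp [prefixProd]

lemma prefixProd_succ (i : Fin p) : prefixProd f (i + 1) = prefixProd f i * f i := by
  have hi : (i : ℕ) < (List.ofFn f).length := by rw [List.length_ofFn]; exact i.2
  rw [prefixProd, List.prod_take_succ _ _ hi]
  simp [prefixProd]

lemma prefixProd_self : prefixProd f p = (List.ofFn f).prod := by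
  rw [prefixProd, List.take_of_length_le (by simp)]

end prefixes

section polygon

variable {n : ℕ} (K : Fin (n + 3) → ℕ∞)

lemma fin_add_one_ne_self (i : Fin (n + 3)) : i + 1 ≠ i := by
  simp

lemma fin_add_one_add_one_ne (i : Fin (n + 3)) : i + 1 + 1 ≠ i := by
  rw [add_assoc, Ne, add_eq_left, Fin.ext_iff, Fin.val_add, Fin.val_one, Fin.val_zero,
    Nat.mod_eq_of_lt (by omega)]
  omega

variable (hK : ∀ i, 2 ≤ K i)

/-- The Coxeter matrix of the reflection group of a polygon with angles `π / k_i`, where `∞` is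
encoded by `0`. -/
def polygonMatrix : CoxeterMatrix (Fin (n + 3)) where
  M := Matrix.of fun i j =>
    if i = j then 1 else if j = i + 1 then (K i).toNat else if i = j + 1 then (K j).toNat else 0
  isSymm := by
    ext i j
    simp only [Matrix.transpose_apply, Matrix.of_apply]
    by_cases h1 : i = j
    · simp [h1]
    · by_cases h2 : j = i + 1
      · have h3 : i ≠ j + 1 := by
          rw [h2]; exact (fin_add_one_add_one_ne i).symm
        rw [if_neg (Ne.symm h1), if_neg h3, if_pos h2, if_neg h1, if_pos h2]
      · simp [h1, Ne.symm h1, h2]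
  diagonal i := by simp
  off_diagonal i j hij := by
    have h1 : ∀ i, (K i).toNat ≠ 1 := fun i h => by
      have h2 := hK i
      have h3 : K i ≠ ⊤ := by rintro h4; simp [h4] at h
      rw [← ENat.natCast_toNat h3, h] at h2
      exact absurd h2 (by decide)
    simp only [Matrix.of_apply, hij, if_false]
    split_ifs
    exacts [h1 _, h1 _, zero_ne_one]

lemma polygonMatrix_succ (i : Fin (n + 3)) : polygonMatrix K hK i (i + 1) = (K i).toNat := by
  change (if i = i + 1 then 1 else if i + 1 = i + 1 then (K i).toNat else _) = _
  rw [if_neg (fin_add_one_ne_self i).symm, if_pos rfl]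

lemma polygonMatrix_eq_zero {i j : Fin (n + 3)} (h1 : i ≠ j) (h2 : j ≠ i + 1) (h3 : i ≠ j + 1) :
    polygonMatrix K hK i j = 0 := by
  change (if i = j then 1 else if j = i + 1 then (K i).toNat else if i = j + 1 then _ else 0) = _
  rw [if_neg h1, if_neg h2, if_neg h3]

/-- The reflection group of a polygon. -/
abbrev PolygonReflectionGroup : Type := (polygonMatrix K hK).Group

/-- The Coxeter system of the reflection group of a polygon. -/
abbrev polygonSystem : CoxeterSystem (polygonMatrix K hK) (PolygonReflectionGroup K hK) :=
  (polygonMatrix K hK).toCoxeterSystem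

/-- The image in the polygon group of the generator `s_i`. -/
def rot (i : Fin (n + 3)) : PolygonGroup K := QuotientGroup.mk (gen K i)

lemma prod_rot : (List.ofFn (rot K)).prod = 1 := by
  have h : (QuotientGroup.mk' (Subgroup.zpowers (coxElt K))) (coxElt K) = 1 :=
    (QuotientGroup.eq_one_iff _).mpr (Subgroup.mem_zpowers _)
  rw [← h]
  refine Eq.trans ?_ (map_list_prod (QuotientGroup.mk' _) _).symm
  rw [List.map_ofFn]
  rfl

lemma rot_pow {i : Fin (n + 3)} {k : ℕ} (h : K i = k) : rot K i ^ k = 1 := by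
  rw [rot, ← QuotientGroup.mk_pow, gen_pow K h, QuotientGroup.mk_one]

lemma prefixProd_rot_self : prefixProd (rot K) (n + 3) = 1 := by
  rw [prefixProd_self, prod_rot]

/-- The index `i + 1` wraps around cyclically; this is harmless because the full product is trivial.
-/
lemma prefixProd_rot_add_one (i : Fin (n + 3)) :
    prefixProd (rot K) ((i + 1 : Fin (n + 3)) : ℕ) = prefixProd (rot K) ((i : ℕ) + 1) := by
  rcases eq_or_ne i (Fin.last _) with rfl | h
  · rw [Fin.last_add_one, Fin.val_last, prefixProd_rot_self]
    simp
  · rw [Fin.val_add_one_of_lt (Fin.lt_last_iff_ne_last.mpr h)]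

/-- The homomorphism from the polygon group determined by the images of the generators. -/
def polygonLift {G : Type*} [Group G] (f : Fin (n + 3) → G) (hc : (List.ofFn f).prod = 1)
    (hk : ∀ i (k : ℕ), K i = k → f i ^ k = 1) : PolygonGroup K →* G :=
  QuotientGroup.lift _ (lift K f (fun i => by rw [hc]; exact Commute.one_left _) hk) (by
    rw [Subgroup.zpowers_le, MonoidHom.mem_ker, lift_coxElt, hc])

@[simp] lemma polygonLift_rot {G : Type*} [Group G] (f : Fin (n + 3) → G)
    (hc : (List.ofFn f).prod = 1) (hk : ∀ i (k : ℕ), K i = k → f i ^ k = 1) (i : Fin (n + 3)) :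
    polygonLift K f hc hk (rot K i) = f i := by
  rw [polygonLift, rot, QuotientGroup.lift_mk, lift_gen]

variable {K} in
lemma polygon_hom_ext {G : Type*} [Group G] {φ ψ : PolygonGroup K →* G}
    (h : ∀ i, φ (rot K i) = ψ (rot K i)) : φ = ψ :=
  QuotientGroup.monoidHom_ext _ (PresentedGroup.ext h)

/-- The orientation-reversing involution of the polygon group. -/
def flip : PolygonGroup K →* PolygonGroup K :=
  -- This models conjugation by `r_0`. With `P_i` the prefix product, `P_i = r_0 r_i`, hence `r_0
  -- (r_i r_{i+1}) r_0 = P_i s_i⁻¹ P_i⁻¹ = P_i P_{i+1}⁻¹`, and the product over all `i` telescopes.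
  polygonLift K (fun i => prefixProd (rot K) i * (rot K i)⁻¹ * (prefixProd (rot K) i)⁻¹)
    (by
      have h := List.prod_ofFn_inv_mul_succ (n + 3) fun m => (prefixProd (rot K) m)⁻¹
      simp only [prefixProd_rot_self, prefixProd_zero, prefixProd_succ, mul_inv_rev, inv_inv,
        inv_one, mul_one, ← mul_assoc] at h
      exact h)
    (fun i k h => by rw [conj_pow, inv_pow, rot_pow K h]; simp)

lemma flip_rot (i : Fin (n + 3)) :
    flip K (rot K i) = prefixProd (rot K) i * (rot K i)⁻¹ * (prefixProd (rot K) i)⁻¹ :=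
  polygonLift_rot _ _ _ _ _

lemma flip_prefixProd {m : ℕ} (hm : m ≤ n + 3) :
    flip K (prefixProd (rot K) m) = (prefixProd (rot K) m)⁻¹ := by
  induction m with
  | zero => simp
  | succ m ih =>
    have h := prefixProd_succ (rot K) ⟨m, by omega⟩
    simp only at h
    rw [h, map_mul, ih (by omega), flip_rot]
    group

lemma flip_flip (x : PolygonGroup K) : flip K (flip K x) = x := by
  have h : (flip K).comp (flip K) = MonoidHom.id _ := by
    apply polygon_hom_ext
    intro i
    rw [MonoidHom.comp_apply, flip_rot, map_mul, map_mul, map_inv, map_inv, flip_rot,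
      flip_prefixProd K i.2.le, MonoidHom.id_apply]
    group
  exact DFunLike.congr_fun h x

/-- The homomorphism from the polygon group to the reflection group of the polygon. -/
def toReflectionGroup : PolygonGroup K →* PolygonReflectionGroup K hK :=
  polygonLift K (fun i => (polygonSystem K hK).simple i * (polygonSystem K hK).simple (i + 1))
    (by
      set cs := polygonSystem K hK
      let g : ℕ → PolygonReflectionGroup K hK := fun m =>
        if h : m < n + 3 then cs.simple ⟨m, h⟩ else cs.simple 0
      have h := List.prod_ofFn_inv_mul_succ (n + 3) g
      have h0 : g 0 = cs.simple 0 := by simp [g]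
      have h1 : g (n + 3) = cs.simple 0 := by simp [g]
      rw [h0, h1, inv_mul_cancel] at h
      rw [← h]
      congr 2
      ext i
      have h2 : g i = cs.simple i := by simp [g]
      have h3 : g ((i : ℕ) + 1) = cs.simple (i + 1) := by
        rcases eq_or_ne i (Fin.last _) with rfl | hl
        · rw [Fin.last_add_one, Fin.val_last, h1]
        · have hlt := Fin.lt_last_iff_ne_last.mpr hl
          have : (i : ℕ) + 1 < n + 3 := by
            rw [Fin.lt_def, Fin.val_last] at hlt; omega
          simp only [g, dif_pos this]
          congr 1
          ext
          rw [Fin.val_add_one_of_lt hlt]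
      rw [h2, h3, CoxeterSystem.inv_simple])
    (fun i k h => by
      have := (polygonSystem K hK).simple_mul_simple_pow i (i + 1)
      rwa [polygonMatrix_succ, h, ENat.toNat_natCast] at this)

lemma toReflectionGroup_rot (i : Fin (n + 3)) : toReflectionGroup K hK (rot K i) =
    (polygonSystem K hK).simple i * (polygonSystem K hK).simple (i + 1) :=
  polygonLift_rot _ _ _ _ _

/-- The permutation of the polygon group by which the `i`-th simple reflection acts. -/
def reflPerm (i : Fin (n + 3)) : Equiv.Perm (PolygonGroup K) :=
  -- In the reflection group this is `x ↦ r_i x r_0`: the right factor `r_0` brings the result back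
  -- among the rotations.
  Function.Involutive.toPerm (fun x => flip K (prefixProd (rot K) i * x)) fun x => by
    simp only [map_mul, map_inv, inv_inv, flip_flip, flip_prefixProd K i.2.le]
    group

lemma reflPerm_apply (i : Fin (n + 3)) (x : PolygonGroup K) :
    reflPerm K i x = flip K (prefixProd (rot K) i * x) := rfl

lemma reflPerm_mul_self (i : Fin (n + 3)) : reflPerm K i * reflPerm K i = 1 := by
  ext1 x
  exact Function.Involutive.toPerm_involutive _ x

lemma reflPerm_mul_succ (i : Fin (n + 3)) :
    reflPerm K i * reflPerm K (i + 1) = Equiv.mulLeft (rot K i) := by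
  ext1 x
  rw [Equiv.Perm.mul_apply, reflPerm_apply, reflPerm_apply, map_mul, flip_flip,
    prefixProd_rot_add_one, prefixProd_succ, flip_prefixProd K i.2.le, Equiv.coe_mulLeft]
  group

lemma reflPerm_isLiftable : (polygonMatrix K hK).IsLiftable (reflPerm K) := by
  have key : ∀ i, (reflPerm K i * reflPerm K (i + 1)) ^ (K i).toNat = 1 := by
    intro i
    rw [reflPerm_mul_succ, Equiv.pow_mulLeft]
    by_cases h : K i = ⊤
    · rw [h, ENat.toNat_top, pow_zero, Equiv.mulLeft_one]
    · rw [rot_pow K (ENat.natCast_toNat h).symm, Equiv.mulLeft_one]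
  intro i j
  by_cases h1 : i = j
  · rw [h1, reflPerm_mul_self, one_pow]
  by_cases h2 : j = i + 1
  · rw [h2, polygonMatrix_succ, key]
  by_cases h3 : i = j + 1
  · rw [h3, (polygonMatrix K hK).symmetric, polygonMatrix_succ]
    have hinv : ∀ i, (reflPerm K i)⁻¹ = reflPerm K i := fun i =>
      (eq_inv_of_mul_eq_one_left (reflPerm_mul_self K i)).symm
    rw [← inv_inj, ← inv_pow, mul_inv_rev, hinv, hinv, key, inv_one]
  · rw [polygonMatrix_eq_zero K hK h1 h2 h3, pow_zero]

/-- The action of the reflection group of a polygon on its polygon group. -/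
def reflAction : PolygonReflectionGroup K hK →* Equiv.Perm (PolygonGroup K) :=
  (polygonSystem K hK).lift ⟨reflPerm K, reflPerm_isLiftable K hK⟩

lemma reflAction_simple (i : Fin (n + 3)) :
    reflAction K hK ((polygonSystem K hK).simple i) = reflPerm K i :=
  (polygonSystem K hK).lift_apply_simple _ _

/-- The action restricts to the left regular representation of the polygon group, which gives the
embedding. -/
lemma reflAction_toReflectionGroup (x y : PolygonGroup K) :
    reflAction K hK (toReflectionGroup K hK x) y = x * y := by
  have h : (reflAction K hK).comp (toReflectionGroup K hK) =
      MulAction.toPermHom (PolygonGroup K) (PolygonGroup K) := by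
    apply polygon_hom_ext
    intro i
    rw [MonoidHom.comp_apply, toReflectionGroup_rot, map_mul, reflAction_simple,
      reflAction_simple, reflPerm_mul_succ]
    rfl
  exact congrFun (congrArg DFunLike.coe (DFunLike.congr_fun h x)) y

lemma toReflectionGroup_injective : Function.Injective (toReflectionGroup K hK) := by
  intro x y h
  have hx := reflAction_toReflectionGroup K hK x 1
  rw [h, reflAction_toReflectionGroup, mul_one, mul_one] at hx
  exact hx.symm

/-- This lets a conjugation by an arbitrary, possibly orientation-reversing, element of the
reflection group be rewritten as a conjugation inside the polygon group. -/
lemma reflAction_eq (w : PolygonReflectionGroup K hK) :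
    ∃ d, (∀ y, reflAction K hK w y = d * y) ∨ ∀ y, reflAction K hK w y = d * flip K y := by
  induction w using (polygonSystem K hK).simple_induction_left with
  | one => exact ⟨1, .inl fun y => by simp⟩
  | mul_simple_left w i ih =>
    obtain ⟨d, h | h⟩ := ih
    · refine ⟨flip K (prefixProd (rot K) i * d), .inr fun y => ?_⟩
      rw [map_mul, Equiv.Perm.mul_apply, h, reflAction_simple, reflPerm_apply, ← map_mul,
        mul_assoc]
    · refine ⟨flip K (prefixProd (rot K) i * d), .inl fun y => ?_⟩
      rw [map_mul, Equiv.Perm.mul_apply, h, reflAction_simple, reflPerm_apply, ← mul_assoc,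
        map_mul _ _ (flip K y), flip_flip]

lemma lengthParity_toReflectionGroup (x : PolygonGroup K) :
    (polygonSystem K hK).lengthParity (toReflectionGroup K hK x) = 1 := by
  have h : (polygonSystem K hK).lengthParity.comp (toReflectionGroup K hK) = 1 := by
    apply polygon_hom_ext
    intro i
    rw [MonoidHom.comp_apply, toReflectionGroup_rot, map_mul,
      CoxeterSystem.lengthParity_simple, CoxeterSystem.lengthParity_simple]
    rfl
  exact DFunLike.congr_fun h x

/-- A proper set of sides of a polygon that pairwise meet lies in a pair of adjacent sides. -/
lemma exists_subset_pair {I : Set (Fin (n + 3))} (hI : I ≠ Set.univ)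
    (hadj : ∀ i ∈ I, ∀ j ∈ I, i = j ∨ j = i + 1 ∨ i = j + 1) :
    (∃ i, I ⊆ {i}) ∨ ∃ i, i ∈ I ∧ i + 1 ∈ I ∧ I ⊆ {i, i + 1} := by
  by_cases hpair : ∃ i, i ∈ I ∧ i + 1 ∈ I
  · obtain ⟨i, hi, hi1⟩ := hpair
    refine .inr ⟨i, hi, hi1, fun j hj => ?_⟩
    by_contra hne
    simp only [Set.mem_insert_iff, Set.mem_singleton_iff, not_or] at hne
    have h1 : i = j + 1 := by
      rcases hadj i hi j hj with h | h | h
      exacts [absurd h.symm hne.1, absurd h hne.2, h]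
    have h2 : j = i + 1 + 1 := by
      rcases hadj _ hi1 j hj with h | h | h
      · exact absurd h.symm hne.2
      · exact h
      · exact absurd (add_right_cancel h).symm hne.1
    -- Now `i = i + 3` cyclically, so the polygon is a triangle and `I` contains all its sides.
    apply hI
    rw [Set.eq_univ_iff_forall]
    have h3 : (1 : Fin (n + 3)) + 1 + 1 = 0 := by
      rw [h2] at h1
      have : i + (1 + 1 + 1) = i := by rw [← add_assoc, ← add_assoc]; exact h1.symm
      rwa [add_eq_left] at this
    have hn : n = 0 := by
      have h4 := congrArg Fin.val h3
      simp only [Fin.val_add, Fin.val_one, Fin.val_zero] at h4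
      rw [Nat.mod_eq_of_lt (show 1 + 1 < n + 3 by omega)] at h4
      by_contra hn0
      rw [Nat.mod_eq_of_lt (by omega)] at h4
      omega
    subst hn
    intro k
    have h5 : ∀ i k : Fin (0 + 3), k = i ∨ k = i + 1 ∨ k = i + 1 + 1 := by decide
    rcases h5 i k with rfl | rfl | rfl
    exacts [hi, hi1, h2 ▸ hj]
  · left
    rcases I.eq_empty_or_nonempty with rfl | ⟨i, hi⟩
    · exact ⟨0, Set.empty_subset _⟩
    · refine ⟨i, fun j hj => ?_⟩
      rcases hadj i hi j hj with h | h | h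
      · exact h.symm
      · exact absurd ⟨i, hi, h ▸ hj⟩ hpair
      · exact absurd ⟨j, hj, h ▸ hi⟩ hpair

/-- The torsion of an infinite polygon group. -/
theorem polygonGroup_torsion [Infinite (PolygonReflectionGroup K hK)] {x : PolygonGroup K}
    (hx : IsOfFinOrder x) :
    x = 1 ∨ ∃ (g : PolygonGroup K) (i : Fin (n + 3)) (m : ℤ),
      K i ≠ ⊤ ∧ x = g * rot K i ^ m * g⁻¹ := by
  set cs := polygonSystem K hK
  obtain ⟨g, I, hI, hM, hmem⟩ := cs.exists_conj_mem_closure_of_isOfFinOrder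
    (MonoidHom.isOfFinOrder (toReflectionGroup K hK) hx)
  set w := g⁻¹ * toReflectionGroup K hK x * g with hw
  have hpar : cs.lengthParity w = 1 := by
    rw [hw, map_mul, map_mul, lengthParity_toReflectionGroup, mul_one, map_inv, inv_mul_cancel]
  have hadj : ∀ i ∈ I, ∀ j ∈ I, i = j ∨ j = i + 1 ∨ i = j + 1 := by
    intro i hi j hj
    by_contra! hcon
    exact hM i hi j hj (polygonMatrix_eq_zero K hK hcon.1 hcon.2.1 hcon.2.2)
  rcases exists_subset_pair hI hadj with ⟨i, hsub⟩ | ⟨i, hi, hi1, hsub⟩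
  · left
    have h1 : w ∈ Subgroup.closure {cs.simple i, cs.simple i} := by
      refine Subgroup.closure_mono ?_ hmem
      rintro _ ⟨j, hj, rfl⟩
      rw [hsub hj]; simp
    have h2 := cs.mem_zpowers_of_mem_closure_pair h1 hpar
    rw [cs.simple_mul_simple_self, Subgroup.zpowers_one_eq_bot, Subgroup.mem_bot] at h2
    apply toReflectionGroup_injective K hK
    rw [map_one]
    have : toReflectionGroup K hK x = g * w * g⁻¹ := by rw [hw]; group
    rw [this, h2]; group
  · right
    have hKi : K i ≠ ⊤ := by
      intro h
      apply hM i hi _ hi1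
      rw [polygonMatrix_succ, h, ENat.toNat_top]
    have h1 : w ∈ Subgroup.closure {cs.simple i, cs.simple (i + 1)} := by
      refine Subgroup.closure_mono ?_ hmem
      rintro _ ⟨j, hj, rfl⟩
      rcases hsub hj with h | h <;> rw [h] <;> simp
    obtain ⟨m, hm⟩ := cs.mem_zpowers_of_mem_closure_pair h1 hpar
    have h2 : toReflectionGroup K hK x * g = g * toReflectionGroup K hK (rot K i ^ m) := by
      rw [map_zpow, toReflectionGroup_rot]
      change _ = g * (cs.simple i * cs.simple (i + 1)) ^ m
      rw [show (cs.simple i * cs.simple (i + 1)) ^ m = w from hm, hw]; group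
    -- Acting on `1` transports the conjugacy to the polygon group; if `g` reverses orientation, the
    -- flip inverts the rotation, whence the exponent `-m`.
    have h3 := congrArg (fun σ => reflAction K hK σ 1) h2
    simp only [map_mul, Equiv.Perm.mul_apply, reflAction_toReflectionGroup, mul_one] at h3
    obtain ⟨d, hd | hd⟩ := reflAction_eq K hK g
    · refine ⟨d, i, m, hKi, ?_⟩
      rw [hd, hd, mul_one] at h3
      rw [← h3, mul_inv_cancel_right]
    · refine ⟨d * prefixProd (rot K) i, i, -m, hKi, ?_⟩
      rw [hd, hd, map_one, mul_one, map_zpow, flip_rot, conj_zpow] at h3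
      rw [eq_mul_inv_of_mul_eq h3, inv_zpow']
      group

end polygon

end GenJ

/-! ### Finiteness from a positive definite form -/

namespace CoxeterSystem

variable {B W : Type*} [Fintype B] [DecidableEq B] [Group W] {M : CoxeterMatrix B}

omit [DecidableEq B] in
lemma _root_.CoxeterMatrix.cosForm_smul (M : CoxeterMatrix B) (t : ℝ) (v : B → ℝ) :
    M.cosForm (t • v) = t ^ 2 * M.cosForm v := by
  simp only [CoxeterMatrix.cosForm, map_smul, Pi.smul_apply, smul_eq_mul, Finset.mul_sum]
  exact Finset.sum_congr rfl fun i _ => by ring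

omit [DecidableEq B] in
lemma _root_.CoxeterMatrix.continuous_cosForm (M : CoxeterMatrix B) : Continuous M.cosForm := by
  unfold CoxeterMatrix.cosForm
  simp only [CoxeterMatrix.cosPairing_apply]
  fun_prop

omit [DecidableEq B] in
lemma _root_.CoxeterMatrix.exists_pos_mul_norm_sq_le (M : CoxeterMatrix B)
    (hpos : ∀ v, v ≠ 0 → 0 < M.cosForm v) :
    ∃ ε > 0, ∀ v, ε * ‖v‖ ^ 2 ≤ M.cosForm v := by
  have hz : M.cosForm 0 = 0 := by simp [CoxeterMatrix.cosForm]
  rcases (Metric.sphere (0 : B → ℝ) 1).eq_empty_or_nonempty with he | hne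
  · refine ⟨1, one_pos, fun v => ?_⟩
    have hv : v = 0 := by
      by_contra hv
      have : ‖v‖⁻¹ • v ∈ Metric.sphere (0 : B → ℝ) 1 := by
        rw [mem_sphere_zero_iff_norm, norm_smul, norm_inv, norm_norm,
          inv_mul_cancel₀ (norm_ne_zero_iff.mpr hv)]
      rw [he] at this
      exact this
    simp [hv, hz]
  · obtain ⟨u, hu, hmin⟩ := (isCompact_sphere (0 : B → ℝ) 1).exists_isMinOn hne
      M.continuous_cosForm.continuousOn
    have hu0 : u ≠ 0 := by
      rintro rfl
      simp at hu
    refine ⟨_, hpos u hu0, fun v => ?_⟩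
    rcases eq_or_ne v 0 with rfl | hv
    · simp [hz]
    have hv' := norm_ne_zero_iff.mpr hv
    have hmem : ‖v‖⁻¹ • v ∈ Metric.sphere (0 : B → ℝ) 1 := by
      rw [mem_sphere_zero_iff_norm, norm_smul, norm_inv, norm_norm, inv_mul_cancel₀ hv']
    have h := isMinOn_iff.mp hmin _ hmem
    rw [M.cosForm_smul, inv_pow, ← div_eq_inv_mul, le_div_iff₀ (by positivity)] at h
    exact h

/-- A Coxeter group whose form is positive definite is finite. -/
theorem finite_of_cosForm_pos (cs : CoxeterSystem M W) (hpos : ∀ v, v ≠ 0 → 0 < M.cosForm v) : Finite W := by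
  by_contra hinf
  have : Infinite W := not_finite_iff_infinite.mp hinf
  obtain ⟨ε, hε, hle⟩ := M.exists_pos_mul_norm_sq_le hpos
  have hsub : cs.posRoots ⊆ Metric.closedBall (0 : B → ℝ) (1 / ε + 1) := by
    intro α hα
    rw [mem_closedBall_zero_iff]
    have h1 := hle α
    rw [cs.cosForm_of_mem_posRoots hα] at h1
    have h2 : ‖α‖ ^ 2 ≤ 1 / ε := by rw [le_div_iff₀ hε]; linarith
    nlinarith [sq_nonneg (‖α‖ - 1)]
  -- All roots have form value `1`, so they are bounded; infinitely many of them accumulate, which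
  -- yields two distinct roots as close as desired.
  obtain ⟨x, -, hx⟩ := cs.infinite_posRoots.exists_accPt_of_subset_isCompact
    (isCompact_closedBall _ _) hsub
  -- Chosen so that `η ≤ 1/4` and `card B * η ≤ 1/4`, the bounds for a coordinate of `u` and for
  -- `⟨e_s, u⟩`.
  set η : ℝ := 1 / (4 * (Fintype.card B + 1)) with hη
  have hη0 : 0 < η := by positivity
  have hcont : ∀ᶠ v in nhds (0 : B → ℝ), M.cosForm v < ε * η ^ 2 := by
    have h0 : M.cosForm 0 < ε * η ^ 2 := by
      have : M.cosForm 0 = 0 := by simp [CoxeterMatrix.cosForm]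
      rw [this]; positivity
    exact M.continuous_cosForm.continuousAt.eventually_lt continuousAt_const h0
  obtain ⟨δ, hδ, hball⟩ := Metric.eventually_nhds_iff_ball.mp hcont
  rw [accPt_iff_nhds] at hx
  have hxx : ∃ α ∈ cs.posRoots, ∃ β ∈ cs.posRoots, β ≠ α ∧ dist β α < δ := by
    obtain ⟨α, ⟨hα1, hα2⟩, hne⟩ := hx _ (Metric.ball_mem_nhds x (half_pos hδ))
    obtain ⟨β, ⟨hβ1, hβ2⟩, -⟩ := hx _ (Metric.ball_mem_nhds x
      (lt_min (half_pos hδ) (dist_pos.mpr hne)))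
    rw [Metric.mem_ball] at hα1 hβ1
    refine ⟨α, hα2, β, hβ2, ?_, ?_⟩
    · rintro rfl
      exact absurd (lt_of_lt_of_le hβ1 (min_le_right _ _)) (lt_irrefl _)
    · have h1 := lt_of_lt_of_le hβ1 (min_le_left _ _)
      calc dist β α ≤ dist β x + dist α x := dist_triangle_right _ _ _
        _ < δ := by linarith
  obtain ⟨α, hα, β, hβ, hne, hdist⟩ := hxx
  obtain ⟨-, w, s, rfl⟩ := hα
  -- Moving `α` to the simple root `e_s` preserves the form of the difference. So `γ` is a positive
  -- root near `e_s` but distinct from it, yet `s` makes its `s`-coordinate close to `-1`.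
  set γ := cs.geomRep w⁻¹ β with hγ
  have hβγ : cs.geomRep w γ = β := cs.geomRep_apply_inv w β
  set u : B → ℝ := γ - Pi.single s 1 with hu
  have hform : M.cosForm u < ε * η ^ 2 := by
    rw [← cs.cosForm_geomRep w, hu, map_sub, hβγ]
    apply hball
    rwa [mem_ball_zero_iff, ← dist_eq_norm]
  have hnorm : ‖u‖ < η := by
    have := (hle u).trans_lt hform
    have := lt_of_mul_lt_mul_left this hε.le
    exact lt_of_pow_lt_pow_left₀ 2 hη0.le this
  have hcoord : ∀ i, |u i| < η := fun i => (norm_le_pi_norm u i).trans_lt hnorm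
  have hη1 : η ≤ 1 / 4 := by
    rw [hη]
    apply one_div_le_one_div_of_le (by norm_num)
    have : (0 : ℝ) ≤ Fintype.card B := Nat.cast_nonneg _
    linarith
  have hγu : γ = Pi.single s 1 + u := by rw [hu]; abel
  have hγs : γ s = 1 + u s := by rw [hγu]; simp
  have hus := abs_lt.mp (hcoord s)
  have hγpos : γ ∈ cs.posRoots := by
    apply cs.geomRep_mem_posRoots hβ
    refine (cs.geomRep_nonneg_or_nonpos hβ w⁻¹).resolve_right fun hneg => ?_
    have : γ s ≤ 0 := hneg s
    linarith
  have hγne : γ ≠ Pi.single s 1 := by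
    intro h
    rw [h] at hβγ
    exact hne hβγ.symm
  have hpair : |M.cosPairing s u| ≤ 1 / 4 := by
    rw [M.cosPairing_apply]
    calc |∑ j, -Real.cos (Real.pi / M s j) * u j| ≤ ∑ j : B, η := by
          refine (Finset.abs_sum_le_sum_abs _ _).trans (Finset.sum_le_sum fun j _ => ?_)
          rw [abs_mul, abs_neg]
          have h1 := Real.abs_cos_le_one (Real.pi / M s j)
          have h2 := (hcoord j).le
          have h3 := abs_nonneg (u j)
          nlinarith [abs_nonneg (Real.cos (Real.pi / M s j))]
      _ = Fintype.card B * η := by simp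
      _ ≤ 1 / 4 := by
          rw [hη, mul_one_div, div_le_div_iff₀ (by positivity) (by norm_num)]
          linarith
  have hfin := cs.reflectionEnd_nonneg hγpos hγne s
  have hval : M.reflectionEnd s γ s = γ s - 2 * M.cosPairing s γ := by
    simp [M.reflectionEnd_apply]
  have hpg : M.cosPairing s γ = 1 + M.cosPairing s u := by
    rw [hγu, map_add, M.cosPairing_single_self]
  rw [hval, hpg, hγs] at hfin
  have := (abs_le.mp hpair).1
  simp only [Pi.zero_apply] at hfin
  linarith

end CoxeterSystem

/-! ### Spherical triangles -/

namespace GenJ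

lemma cos_add_cos_mul_cos_lt {α β γ : ℝ} (hα : 0 < α) (hα' : α ≤ Real.pi / 2)
    (hβ' : β ≤ Real.pi / 2) (hγ : γ ≤ Real.pi / 2)
    (hsum : Real.pi < α + β + γ) :
    Real.cos γ + Real.cos α * Real.cos β < Real.sin α * Real.sin β := by
  have h1 : Real.cos γ < Real.cos (Real.pi - α - β) :=
    Real.cos_lt_cos_of_nonneg_of_le_pi (by linarith) (by linarith [Real.pi_pos]) (by linarith)
  rw [show Real.pi - α - β = Real.pi - (α + β) by ring, Real.cos_pi_sub, Real.cos_add] at h1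
  linarith

lemma pi_div_mem {k : ℕ} (hk : 2 ≤ k) :
    0 < Real.pi / k ∧ Real.pi / k ≤ Real.pi / 2 := by
  have h2 : (2 : ℝ) ≤ k := by exact_mod_cast hk
  have h := Real.pi_pos
  exact ⟨by positivity, div_le_div_of_nonneg_left h.le (by norm_num) h2⟩

/-- Complete the square in `x`, then in `y, z` with `sa * y - sc * z` or `sa * y + sc * z` according
to the sign of `y * z`, so that the remaining mixed term is nonnegative. -/
lemma ternary_form_pos {a b c sa sc : ℝ} (ha : sa ^ 2 = 1 - a ^ 2) (hc : sc ^ 2 = 1 - c ^ 2)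
    (ha0 : 0 ≤ a) (hb0 : 0 ≤ b) (hc0 : 0 ≤ c) (hsa : 0 < sa) (hsc : 0 < sc)
    (hD : b + a * c < sa * sc) {x y z : ℝ} (h : ¬ (x = 0 ∧ y = 0 ∧ z = 0)) :
    0 < x ^ 2 + y ^ 2 + z ^ 2 - 2 * a * x * y - 2 * b * y * z - 2 * c * x * z := by
  have hid : x ^ 2 + y ^ 2 + z ^ 2 - 2 * a * x * y - 2 * b * y * z - 2 * c * x * z =
      (x - a * y - c * z) ^ 2 + (sa * y - sc * z) ^ 2 +
        2 * (sa * sc - (b + a * c)) * y * z := by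
    linear_combination (-y ^ 2) * ha - z ^ 2 * hc
  have hid2 : x ^ 2 + y ^ 2 + z ^ 2 - 2 * a * x * y - 2 * b * y * z - 2 * c * x * z =
      (x - a * y - c * z) ^ 2 + (sa * y + sc * z) ^ 2 -
        2 * (sa * sc + (b + a * c)) * y * z := by
    linear_combination (-y ^ 2) * ha - z ^ 2 * hc
  have hac : 0 ≤ b + a * c := by positivity
  rcases lt_trichotomy (y * z) 0 with hyz | hyz | hyz
  · rw [hid2]
    nlinarith [sq_nonneg (x - a * y - c * z), sq_nonneg (sa * y + sc * z), mul_pos hsa hsc]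
  · rcases mul_eq_zero.mp hyz with rfl | rfl
    · by_cases hz : z = 0
      · subst hz
        have hx : x ≠ 0 := fun hx => h ⟨hx, rfl, rfl⟩
        have := pow_pos (abs_pos.mpr hx) 2
        rw [sq_abs] at this
        linarith
      · rw [hid]
        have : 0 < (sa * 0 - sc * z) ^ 2 := by
          have : sa * 0 - sc * z ≠ 0 := by
            simp [hz, hsc.ne']
          positivity
        nlinarith [sq_nonneg (x - a * 0 - c * z)]
    · by_cases hy : y = 0
      · subst hy
        have hx : x ≠ 0 := fun hx => h ⟨hx, rfl, rfl⟩
        have := pow_pos (abs_pos.mpr hx) 2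
        rw [sq_abs] at this
        linarith
      · rw [hid]
        have : 0 < (sa * y - sc * 0) ^ 2 := by
          have : sa * y - sc * 0 ≠ 0 := by
            simp [hy, hsa.ne']
          positivity
        nlinarith [sq_nonneg (x - a * y - c * 0)]
  · rw [hid]
    nlinarith [sq_nonneg (x - a * y - c * z), sq_nonneg (sa * y - sc * z),
      mul_pos (sub_pos.mpr hD) hyz]

/-- Spherical triangle groups are finite. -/
theorem finite_reflectionGroup_of_spherical (K : Fin 3 → ℕ∞) (hK : ∀ i, 2 ≤ K i) (k : Fin 3 → ℕ)
    (hk : ∀ i, K i = k i) (hsum : Real.pi < Real.pi / k 0 + Real.pi / k 1 + Real.pi / k 2) :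
    Finite (PolygonReflectionGroup (n := 0) K hK) := by
  have hk2 : ∀ i, 2 ≤ k i := fun i => by
    have := hK i
    rw [hk] at this
    exact_mod_cast this
  refine (polygonSystem (n := 0) K hK).finite_of_cosForm_pos fun v hv => ?_
  set M := polygonMatrix (n := 0) K hK
  have h01 : M 0 1 = k 0 := by
    rw [show (1 : Fin 3) = 0 + 1 from rfl, polygonMatrix_succ, hk, ENat.toNat_natCast]
  have h12 : M 1 2 = k 1 := by
    rw [show (2 : Fin 3) = 1 + 1 from rfl, polygonMatrix_succ, hk, ENat.toNat_natCast]
  have h20 : M 2 0 = k 2 := by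
    rw [show (0 : Fin 3) = 2 + 1 from rfl, polygonMatrix_succ, hk, ENat.toNat_natCast]
  have hcos : ∀ i, 0 ≤ Real.cos (Real.pi / k i) := fun i =>
    Real.cos_nonneg_of_neg_pi_div_two_le_of_le
      (by linarith [(pi_div_mem (hk2 i)).1, Real.pi_pos]) (pi_div_mem (hk2 i)).2
  have hform : M.cosForm v = v 0 ^ 2 + v 1 ^ 2 + v 2 ^ 2 -
      2 * Real.cos (Real.pi / k 0) * v 0 * v 1 - 2 * Real.cos (Real.pi / k 1) * v 1 * v 2 -
      2 * Real.cos (Real.pi / k 2) * v 0 * v 2 := by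
    have hsum3 : ∀ f : Fin (0 + 3) → ℝ, ∑ i, f i = f 0 + f 1 + f 2 := Fin.sum_univ_three
    simp only [CoxeterMatrix.cosForm, CoxeterMatrix.cosPairing_apply, hsum3,
      M.diagonal, M.symmetric 1 0, M.symmetric 2 1, M.symmetric 0 2, h01, h12, h20, Nat.cast_one,
      div_one, Real.cos_pi]
    ring
  rw [hform]
  have h0 := pi_div_mem (hk2 0)
  have h1 := pi_div_mem (hk2 1)
  have h2 := pi_div_mem (hk2 2)
  refine ternary_form_pos (Real.sin_sq _) (Real.sin_sq _) (hcos 0) (hcos 1) (hcos 2)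
    (sin_pi_div_pos (hk2 0)) (sin_pi_div_pos (hk2 2))
    (cos_add_cos_mul_cos_lt h0.1 h0.2 h2.2 h1.2 (by linarith)) ?_
  rintro ⟨hx, hy, hz⟩
  apply hv
  ext i
  fin_cases i <;> assumption

end GenJ

/-! ### Lifts of Möbius transformations to `ℍ × ℝ` -/

open scoped MatrixGroups UpperHalfPlane ComplexConjugate

/-- The permutation `(x, r) ↦ (g x, r + A x)` of `X × ℝ`. -/
def shear {G X : Type*} [Group G] [MulAction G X] (g : G) (A : X → ℝ) : Equiv.Perm (X × ℝ) where
  toFun q := (g • q.1, q.2 + A q.1)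
  invFun q := (g⁻¹ • q.1, q.2 - A (g⁻¹ • q.1))
  left_inv q := by simp
  right_inv q := by simp

section shear

variable {G X : Type*} [Group G] [MulAction G X]

lemma shear_apply (g : G) (A : X → ℝ) (q : X × ℝ) : shear g A q = (g • q.1, q.2 + A q.1) := rfl

lemma shear_mul (g h : G) (A B : X → ℝ) :
    shear g A * shear h B = shear (g * h) fun x => B x + A (h • x) := by
  ext1 q
  simp [shear_apply, mul_smul, add_assoc]

lemma shear_pow (g : G) (A : X → ℝ) (n : ℕ) :
    shear g A ^ n = shear (g ^ n) fun x => ∑ l ∈ Finset.range n, A (g ^ l • x) := by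
  induction n with
  | zero => ext1 q; simp [shear_apply]
  | succ n ih =>
    rw [pow_succ', ih, shear_mul, ← pow_succ']
    simp only [Finset.sum_range_succ]

/-- A nontrivial translation of the fibres that fixes the base has infinite order. -/
lemma not_isOfFinOrder_of_translation {X : Type*} [Nonempty X] {σ : Equiv.Perm (X × ℝ)} {δ : ℝ}
    (hσ : ∀ q, σ q = (q.1, q.2 + δ)) (hδ : δ ≠ 0) : ¬ IsOfFinOrder σ := by
  intro h
  obtain ⟨n, hn, hpow⟩ := isOfFinOrder_iff_pow_eq_one.mp h
  obtain ⟨x⟩ := ‹Nonempty X›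
  have key : ∀ m : ℕ, (σ ^ m) (x, 0) = (x, m * δ) := by
    intro m
    induction m with
    | zero => simp
    | succ m ih => rw [pow_succ', Equiv.Perm.mul_apply, ih, hσ]; push_cast; simp; ring
  have := key n
  rw [hpow, Equiv.Perm.one_apply, Prod.mk.injEq] at this
  have h2 := this.2.symm
  rw [mul_eq_zero, Nat.cast_eq_zero] at h2
  exact h2.elim hn.ne' hδ

end shear

/-- The factor of automorphy `c τ + d` on the upper half-plane. -/
noncomputable def autFactor (g : SL(2, ℝ)) (τ : ℍ) : ℂ := g 1 0 * τ + g 1 1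

lemma autFactor_ne_zero (g : SL(2, ℝ)) (τ : ℍ) : autFactor g τ ≠ 0 :=
  UpperHalfPlane.denom_ne_zero (g : GL (Fin 2) ℝ) τ

lemma coe_smul_eq (g : SL(2, ℝ)) (τ : ℍ) :
    ((g • τ : ℍ) : ℂ) = (g 0 0 * τ + g 0 1) / autFactor g τ :=
  UpperHalfPlane.coe_specialLinearGroup_apply g τ

lemma autFactor_mul (g h : SL(2, ℝ)) (τ : ℍ) :
    autFactor (g * h) τ = autFactor g (h • τ) * autFactor h τ := by
  have hne := autFactor_ne_zero h τ
  rw [autFactor, autFactor, coe_smul_eq, add_mul, mul_assoc, div_mul_cancel₀ _ hne]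
  simp [autFactor, Matrix.mul_apply, Fin.sum_univ_two]
  ring

lemma autFactor_neg_one (τ : ℍ) : autFactor (-1) τ = -1 := by
  simp [autFactor]

lemma autFactor_one (τ : ℍ) : autFactor 1 τ = 1 := by
  simp [autFactor]

lemma neg_one_smul_upperHalfPlane (τ : ℍ) : (-1 : SL(2, ℝ)) • τ = τ := by
  ext
  rw [coe_smul_eq, autFactor_neg_one]
  simp

lemma autFactor_im_pos {g : SL(2, ℝ)} (hg : 0 < g 1 0) (τ : ℍ) : 0 < (autFactor g τ).im := by
  simp [autFactor, hg, τ.im_pos]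

/-- A positive lower-left entry keeps `c τ + d` in the upper half-plane, away from the branch cut of
the argument. -/
lemma arg_autFactor_mem {g : SL(2, ℝ)} (hg : 0 < g 1 0) (τ : ℍ) :
    0 < (autFactor g τ).arg ∧ (autFactor g τ).arg < Real.pi := by
  have h := autFactor_im_pos hg τ
  refine ⟨lt_of_le_of_ne (Complex.arg_nonneg_iff.mpr h.le) fun h0 => ?_,
    Complex.arg_lt_pi_iff.mpr (.inr h.ne')⟩
  exact h.ne' (Complex.arg_eq_zero_iff.mp h0.symm).2

lemma continuous_arg_autFactor {g : SL(2, ℝ)} (hg : 0 < g 1 0) :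
    Continuous fun τ : ℍ => (autFactor g τ).arg := by
  rw [continuous_iff_continuousAt]
  intro τ
  refine ContinuousAt.comp (g := Complex.arg) ?_ ?_
  · exact Complex.continuousAt_arg (.inr (autFactor_im_pos hg τ).ne')
  · unfold autFactor
    fun_prop

/-- The lift to `ℍ × ℝ` of a Möbius transformation `g`, followed by a translation by `-θ`. -/
noncomputable def moebiusLift (g : SL(2, ℝ)) (θ : ℝ) : Equiv.Perm (ℍ × ℝ) :=
  shear g fun τ => (autFactor g τ).arg - θ

lemma coe_sum_arg_autFactor (g : SL(2, ℝ)) (τ : ℍ) (n : ℕ) :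
    ((∑ l ∈ Finset.range n, (autFactor g (g ^ l • τ)).arg : ℝ) : Real.Angle) =
      (autFactor (g ^ n) τ).arg := by
  induction n with
  | zero => simp [autFactor_one]
  | succ n ih =>
    rw [Finset.sum_range_succ, Real.Angle.coe_add, ih, pow_succ', autFactor_mul,
      Complex.arg_mul_coe_angle (autFactor_ne_zero _ _) (autFactor_ne_zero _ _), add_comm]

/-- Cayley–Hamilton for determinant `1` is the Chebyshev recursion. -/
lemma pow_eq_of_trace_eq {g : SL(2, ℝ)} {c : ℝ} (ht : g 0 0 + g 1 1 = 2 * c) (n : ℕ) :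
    ((g ^ (n + 1) : SL(2, ℝ)) : Matrix (Fin 2) (Fin 2) ℝ) =
      chebyshevSeq c (n + 1) • (g : Matrix (Fin 2) (Fin 2) ℝ) - chebyshevSeq c n • 1 := by
  have hsq : (g : Matrix (Fin 2) (Fin 2) ℝ) * g = (2 * c) • (g : Matrix (Fin 2) (Fin 2) ℝ) - 1 := by
    have hdet := g.det_coe
    rw [Matrix.det_fin_two] at hdet
    ext i j
    fin_cases i <;> fin_cases j <;> simp [Matrix.mul_apply, Fin.sum_univ_two, ← ht] <;>
      first | linear_combination -hdet | ring
  induction n with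
  | zero => simp
  | succ n ih =>
    rw [pow_succ, Matrix.SpecialLinearGroup.coe_mul, ih, sub_mul, smul_mul_assoc, hsq,
      chebyshevSeq_add_two]
    simp only [smul_mul_assoc, one_mul]
    module

/-- An elliptic element of rotation angle `π / k` has `k`-th power `-1`. -/
lemma pow_eq_neg_one {g : SL(2, ℝ)} {k : ℕ} (hk : 2 ≤ k)
    (ht : g 0 0 + g 1 1 = 2 * Real.cos (Real.pi / k)) : g ^ k = -1 := by
  obtain ⟨n, rfl⟩ : ∃ n, k = n + 1 := ⟨k - 1, by omega⟩
  have hs := sin_pi_div_pos hk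
  set θ := Real.pi / ((n + 1 : ℕ) : ℝ) with hθ
  have hkθ : ((n + 1 : ℕ) : ℝ) * θ = Real.pi := by
    have : ((n + 1 : ℕ) : ℝ) ≠ 0 := by positivity
    rw [hθ]; field_simp
  have e1 : chebyshevSeq (Real.cos θ) (n + 1) = 0 := by
    apply mul_right_cancel₀ hs.ne'
    rw [chebyshevSeq_cos_mul_sin, hkθ, Real.sin_pi, zero_mul]
  have e2 : chebyshevSeq (Real.cos θ) n = 1 := by
    apply mul_right_cancel₀ hs.ne'
    rw [chebyshevSeq_cos_mul_sin, one_mul,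
      show (n : ℝ) * θ = Real.pi - θ by rw [← hkθ]; push_cast; ring, Real.sin_pi_sub]
  apply Subtype.ext
  rw [pow_eq_of_trace_eq ht, e1, e2]
  simp

/-- The fixed point of an elliptic element in the upper half-plane. -/
lemma exists_fixedPoint {g : SL(2, ℝ)} (hg : 0 < g 1 0) {k : ℕ} (hk : 2 ≤ k)
    (ht : g 0 0 + g 1 1 = 2 * Real.cos (Real.pi / k)) :
    ∃ τ : ℍ, g • τ = τ ∧ (autFactor g τ).arg = Real.pi / k := by
  have hs := sin_pi_div_pos hk
  have hθ : 0 < Real.pi / k ∧ Real.pi / k ≤ Real.pi / 2 := GenJ.pi_div_mem hk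
  set θ := Real.pi / k
  set w : ℂ := Real.cos θ + Real.sin θ * Complex.I with hw
  have hc : ((g 1 0 : ℝ) : ℂ) ≠ 0 := by exact_mod_cast hg.ne'
  have him : 0 < ((w - g 1 1) / (g 1 0 : ℝ) : ℂ).im := by
    rw [Complex.div_ofReal_im, hw]
    simp
    positivity
  let τ : ℍ := ⟨(w - g 1 1) / (g 1 0 : ℝ), him⟩
  have hτ : (τ : ℂ) = (w - g 1 1) / (g 1 0 : ℝ) := rfl
  have haut : autFactor g τ = w := by
    rw [autFactor, hτ]; field_simp; ring
  refine ⟨τ, ?_, ?_⟩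
  · ext
    have hw0 : w ≠ 0 := haut ▸ autFactor_ne_zero g τ
    rw [coe_smul_eq, haut, div_eq_iff hw0, hτ]
    have hdet := g.det_coe
    rw [Matrix.det_fin_two] at hdet
    have hdet' : (g 0 0 * g 1 1 - g 0 1 * g 1 0 : ℂ) = 1 := by exact_mod_cast hdet
    have ht' : (g 0 0 + g 1 1 : ℂ) = 2 * (Real.cos θ : ℝ) := by exact_mod_cast ht
    have hcs : ((Real.cos θ : ℝ) : ℂ) ^ 2 + ((Real.sin θ : ℝ) : ℂ) ^ 2 = 1 := by
      exact_mod_cast Real.cos_sq_add_sin_sq θ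
    have hw2 : w ^ 2 = 2 * (Real.cos θ : ℝ) * w - 1 := by
      rw [hw]
      linear_combination ((Real.sin θ : ℝ) : ℂ) ^ 2 * Complex.I_sq - hcs
    field_simp
    linear_combination w * ht' - hw2 - hdet'
  · rw [haut, hw, Complex.ofReal_cos, Complex.ofReal_sin]
    exact Complex.arg_cos_add_sin_mul_I ⟨by linarith [Real.pi_pos], by linarith [Real.pi_pos]⟩

/-- The normalized lift of an elliptic element has finite order. -/
lemma moebiusLift_pow {g : SL(2, ℝ)} (hg : 0 < g 1 0) {k : ℕ} (hk : 2 ≤ k)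
    (ht : g 0 0 + g 1 1 = 2 * Real.cos (Real.pi / k)) :
    moebiusLift g (Real.pi / k) ^ k = 1 := by
  have hgk := pow_eq_neg_one hk ht
  have hkR : (k : ℝ) ≠ 0 := by positivity
  let h : ℍ → ℝ := fun τ => ∑ l ∈ Finset.range k, (autFactor g (g ^ l • τ)).arg
  have hcont : Continuous h := by
    refine continuous_finsetSum _ fun l _ => ?_
    exact (continuous_arg_autFactor hg).comp (continuous_const_smul _)
  have hint : ∀ τ, h τ - Real.pi ∈ AddSubgroup.zmultiples (2 * Real.pi) := by
    intro τ
    have h1 : ((h τ : ℝ) : Real.Angle) = (Real.pi : ℝ) := by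
      simp only [h]
      rw [coe_sum_arg_autFactor, hgk, autFactor_neg_one, Complex.arg_neg_one]
    obtain ⟨m, hm⟩ := Real.Angle.angle_eq_iff_two_pi_dvd_sub.mp h1
    exact ⟨m, by simp only [zsmul_eq_mul]; rw [hm]; ring⟩
  obtain ⟨τ₀, hfix, harg⟩ := exists_fixedPoint hg hk ht
  have hτ₀ : h τ₀ = Real.pi := by
    have hl : ∀ l : ℕ, g ^ l • τ₀ = τ₀ := fun l => by
      induction l with
      | zero => simp
      | succ l ih => rw [pow_succ, mul_smul, hfix, ih]
    simp only [h, hl, harg, Finset.sum_const, Finset.card_range, nsmul_eq_mul]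
    field_simp
  have hall : ∀ τ, h τ = Real.pi := by
    intro τ
    -- The function `h - π` is continuous with values in the discrete group `2πℤ`, hence constant;
    -- at the fixed point all `k` summands of `h` equal `π / k`.
    have := (isPreconnected_univ (α := ℍ)).constant_of_mapsTo
      (T := (AddSubgroup.zmultiples (2 * Real.pi) : Set ℝ)) (f := fun τ => h τ - Real.pi)
      ⟨inferInstanceAs (DiscreteTopology (AddSubgroup.zmultiples (2 * Real.pi)))⟩ (hcont.sub continuous_const).continuousOn (fun τ _ => hint τ)
      (Set.mem_univ τ) (Set.mem_univ τ₀)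
    linarith
  ext1 q
  rw [moebiusLift, shear_pow, shear_apply, hgk, neg_one_smul_upperHalfPlane]
  have : ∑ l ∈ Finset.range k, ((autFactor g (g ^ l • q.1)).arg - Real.pi / k) = 0 := by
    rw [Finset.sum_sub_distrib]
    change h q.1 - _ = 0
    rw [hall, Finset.sum_const, Finset.card_range, nsmul_eq_mul]
    field_simp
    ring
  simp [this]

/-- The product of lifts of three Möbius transformations with product `-1`. -/
lemma moebiusLift_mul_three {g₀ g₁ g₂ : SL(2, ℝ)} (h₀ : 0 < g₀ 1 0) (h₁ : 0 < g₁ 1 0)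
    (h₂ : 0 < g₂ 1 0) (hprod : g₀ * g₁ * g₂ = -1) (θ₀ θ₁ θ₂ : ℝ) (q : ℍ × ℝ) :
    (moebiusLift g₀ θ₀ * moebiusLift g₁ θ₁ * moebiusLift g₂ θ₂) q =
      (q.1, q.2 + (Real.pi - (θ₀ + θ₁ + θ₂))) := by
  obtain ⟨τ, r⟩ := q
  have a₂ := arg_autFactor_mem h₂ τ
  have a₁ := arg_autFactor_mem h₁ (g₂ • τ)
  have a₀ := arg_autFactor_mem h₀ (g₁ • g₂ • τ)
  have hang : (((autFactor g₀ (g₁ • g₂ • τ)).arg + (autFactor g₁ (g₂ • τ)).arg +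
      (autFactor g₂ τ).arg : ℝ) : Real.Angle) = (Real.pi : ℝ) := by
    rw [← Complex.arg_neg_one, ← autFactor_neg_one τ, ← hprod, autFactor_mul, autFactor_mul,
      Complex.arg_mul_coe_angle (mul_ne_zero (autFactor_ne_zero _ _) (autFactor_ne_zero _ _))
        (autFactor_ne_zero _ _),
      Complex.arg_mul_coe_angle (autFactor_ne_zero _ _) (autFactor_ne_zero _ _)]
    simp
  obtain ⟨m, hm⟩ := Real.Angle.angle_eq_iff_two_pi_dvd_sub.mp hang
  have hπ := Real.pi_pos
  -- The sum of the three arguments lies in `(0, 3π)` and is `π` modulo `2π`, so it is exactly `π`.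
  have hm0 : m = 0 := by
    have l1 : (-1 : ℝ) < m := by
      by_contra hcon
      push Not at hcon
      nlinarith
    have l2 : (m : ℝ) < 1 := by
      by_contra hcon
      push Not at hcon
      nlinarith
    have l1' : -1 < m := by exact_mod_cast l1
    have l2' : m < 1 := by exact_mod_cast l2
    omega
  rw [hm0] at hm
  have hsm : g₀ • g₁ • g₂ • τ = τ := by
    rw [← mul_smul, ← mul_smul, hprod, neg_one_smul_upperHalfPlane]
  simp only [Equiv.Perm.mul_apply, moebiusLift, shear_apply, hsm]
  push_cast at hm
  ext
  · rfl
  · simp only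
    linarith

/-- The product of lifts of four Möbius transformations with product `1`. -/
lemma moebiusLift_mul_four {g₀ g₁ g₂ g₃ : SL(2, ℝ)} (h₀ : 0 < g₀ 1 0) (h₁ : 0 < g₁ 1 0)
    (h₂ : 0 < g₂ 1 0) (h₃ : 0 < g₃ 1 0) (hprod : g₀ * g₁ * g₂ * g₃ = 1) (θ₀ θ₁ θ₂ θ₃ : ℝ)
    (q : ℍ × ℝ) :
    (moebiusLift g₀ θ₀ * moebiusLift g₁ θ₁ * moebiusLift g₂ θ₂ * moebiusLift g₃ θ₃) q =
      (q.1, q.2 + (2 * Real.pi - (θ₀ + θ₁ + θ₂ + θ₃))) := by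
  obtain ⟨τ, r⟩ := q
  have a₃ := arg_autFactor_mem h₃ τ
  have a₂ := arg_autFactor_mem h₂ (g₃ • τ)
  have a₁ := arg_autFactor_mem h₁ (g₂ • g₃ • τ)
  have a₀ := arg_autFactor_mem h₀ (g₁ • g₂ • g₃ • τ)
  have hang : (((autFactor g₀ (g₁ • g₂ • g₃ • τ)).arg + (autFactor g₁ (g₂ • g₃ • τ)).arg +
      (autFactor g₂ (g₃ • τ)).arg + (autFactor g₃ τ).arg : ℝ) : Real.Angle) = ((0 : ℝ)) := by
    rw [← Complex.arg_one, ← autFactor_one τ, ← hprod, autFactor_mul, autFactor_mul,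
      autFactor_mul,
      Complex.arg_mul_coe_angle (mul_ne_zero (mul_ne_zero (autFactor_ne_zero _ _)
        (autFactor_ne_zero _ _)) (autFactor_ne_zero _ _)) (autFactor_ne_zero _ _),
      Complex.arg_mul_coe_angle (mul_ne_zero (autFactor_ne_zero _ _) (autFactor_ne_zero _ _))
        (autFactor_ne_zero _ _),
      Complex.arg_mul_coe_angle (autFactor_ne_zero _ _) (autFactor_ne_zero _ _)]
    simp
  obtain ⟨m, hm⟩ := Real.Angle.angle_eq_iff_two_pi_dvd_sub.mp hang
  have hπ := Real.pi_pos
  -- The sum of the four arguments lies in `(0, 4π)` and is `0` modulo `2π`, so it is exactly `2π`.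
  have hm1 : m = 1 := by
    have l1 : (0 : ℝ) < m := by
      by_contra hcon
      push Not at hcon
      nlinarith
    have l2 : (m : ℝ) < 2 := by
      by_contra hcon
      push Not at hcon
      nlinarith
    have l1' : 0 < m := by exact_mod_cast l1
    have l2' : m < 2 := by exact_mod_cast l2
    omega
  rw [hm1] at hm
  have hsm : g₀ • g₁ • g₂ • g₃ • τ = τ := by
    rw [← mul_smul, ← mul_smul, ← mul_smul, hprod, one_smul]
  simp only [Equiv.Perm.mul_apply, moebiusLift, shear_apply, hsm]
  push_cast at hm
  ext
  · rfl
  · simp only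
    linarith

/-- The three rotations of a hyperbolic triangle. -/
lemma exists_hyperbolic_triangle {α β γ : ℝ} (hα : 0 < α) (hα' : α ≤ Real.pi / 2) (hβ : 0 < β)
    (hβ' : β ≤ Real.pi / 2) (hγ : 0 < γ) (hsum : α + β + γ < Real.pi) :
    ∃ g₀ g₁ g₂ : SL(2, ℝ), g₀ * g₁ * g₂ = -1 ∧ 0 < g₀ 1 0 ∧ 0 < g₁ 1 0 ∧ 0 < g₂ 1 0 ∧
      g₀ 0 0 + g₀ 1 1 = 2 * Real.cos α ∧ g₁ 0 0 + g₁ 1 1 = 2 * Real.cos β ∧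
      g₂ 0 0 + g₂ 1 1 = 2 * Real.cos γ := by
  have hπ := Real.pi_pos
  have hsα : 0 < Real.sin α := Real.sin_pos_of_pos_of_lt_pi hα (by linarith)
  have hsβ : 0 < Real.sin β := Real.sin_pos_of_pos_of_lt_pi hβ (by linarith)
  have hcα : 0 ≤ Real.cos α := Real.cos_nonneg_of_neg_pi_div_two_le_of_le (by linarith) hα'
  have hcβ : 0 ≤ Real.cos β := Real.cos_nonneg_of_neg_pi_div_two_le_of_le (by linarith) hβ'
  -- By the hyperbolic law of cosines, `t` is the `cosh` of the side between the vertices with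
  -- angles `α, β`, and `l` below is the exponential of its length. The vertices are put at `i` and
  -- `l i`, fixed by `g₀` and `g₁`.
  set t := (Real.cos α * Real.cos β + Real.cos γ) / (Real.sin α * Real.sin β) with ht
  have hts : t * (Real.sin α * Real.sin β) = Real.cos α * Real.cos β + Real.cos γ := by
    rw [ht]; field_simp
  have ht1 : 1 ≤ t := by
    rw [ht, le_div_iff₀ (by positivity), one_mul]
    have h1 : Real.cos (Real.pi - α - β) ≤ Real.cos γ :=
      Real.cos_le_cos_of_nonneg_of_le_pi hγ.le (by linarith) (by linarith)
    rw [show Real.pi - α - β = Real.pi - (α + β) by ring, Real.cos_pi_sub, Real.cos_add] at h1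
    linarith
  set l := t + Real.sqrt (t ^ 2 - 1) with hl
  have hsq : Real.sqrt (t ^ 2 - 1) ^ 2 = t ^ 2 - 1 := Real.sq_sqrt (by nlinarith)
  have hl0 : 0 < l := by
    have := Real.sqrt_nonneg (t ^ 2 - 1)
    linarith
  have hlinv : l⁻¹ = t - Real.sqrt (t ^ 2 - 1) := by
    rw [inv_eq_iff_eq_inv, eq_comm]
    apply inv_eq_of_mul_eq_one_left
    rw [hl]; linear_combination -hsq
  have hll : l + l⁻¹ = 2 * t := by rw [hlinv]; ring
  have hl0' : 0 < l⁻¹ := inv_pos.mpr hl0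
  have hllinv : l * l⁻¹ = 1 := mul_inv_cancel₀ hl0.ne'
  generalize l⁻¹ = l' at *
  clear_value l t
  let g₀ : SL(2, ℝ) := ⟨!![Real.cos α, -Real.sin α; Real.sin α, Real.cos α], by
    rw [Matrix.det_fin_two_of]; linear_combination Real.cos_sq_add_sin_sq α⟩
  let g₁ : SL(2, ℝ) := ⟨!![Real.cos β, -(l * Real.sin β); l' * Real.sin β, Real.cos β], by
    rw [Matrix.det_fin_two_of]
    linear_combination Real.cos_sq_add_sin_sq β + Real.sin β ^ 2 * hllinv⟩
  have hM : ((g₀ * g₁ : SL(2, ℝ)) : Matrix (Fin 2) (Fin 2) ℝ) =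
      !![Real.cos α, -Real.sin α; Real.sin α, Real.cos α] *
        !![Real.cos β, -(l * Real.sin β); l' * Real.sin β, Real.cos β] := rfl
  have hpos : 0 < Real.sin α * Real.cos β + Real.cos α * (l' * Real.sin β) := by
    by_cases h : α = Real.pi / 2
    · have : 0 < Real.cos β := Real.cos_pos_of_mem_Ioo ⟨by linarith, by linarith⟩
      positivity
    · have : 0 < Real.cos α :=
        Real.cos_pos_of_mem_Ioo ⟨by linarith, lt_of_le_of_ne hα' h⟩
      positivity
  refine ⟨g₀, g₁, -(g₀ * g₁)⁻¹, by simp, hsα, ?_, ?_, ?_, ?_, ?_⟩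
  · change 0 < l' * Real.sin β
    positivity
  · rw [Matrix.SpecialLinearGroup.coe_neg, Matrix.SpecialLinearGroup.coe_inv,
      Matrix.adjugate_fin_two, hM]
    simpa [Matrix.mul_apply, Fin.sum_univ_two] using hpos
  · change Real.cos α + Real.cos α = _
    ring
  · change Real.cos β + Real.cos β = _
    ring
  · rw [Matrix.SpecialLinearGroup.coe_neg, Matrix.SpecialLinearGroup.coe_inv,
      Matrix.adjugate_fin_two, hM]
    simp [Matrix.mul_apply, Fin.sum_univ_two]
    linear_combination (Real.sin α * Real.sin β) * hll + 2 * hts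

/-- Two rotations of given angles whose product is a given hyperbolic element. -/
lemma exists_mul_eq_neg_diag (a b : ℝ) {e e' : ℝ} (he : 0 < e) (hee : e * e' = 1) (hne : e ≠ e') :
    ∃ g₀ g₁ : SL(2, ℝ), ((g₀ * g₁ : SL(2, ℝ)) : Matrix (Fin 2) (Fin 2) ℝ) = !![-e, 0; 0, -e'] ∧
      0 < g₀ 1 0 ∧ 0 < g₁ 1 0 ∧ g₀ 0 0 + g₀ 1 1 = 2 * a ∧ g₁ 0 0 + g₁ 1 1 = 2 * b := by
  have hsub : e - e' ≠ 0 := sub_ne_zero.mpr hne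
  -- With `g₀` of lower-left entry `1` and trace `2 a`, the product determines `g₁`; its trace
  -- condition is linear in `d`.
  set d := -(2 * b + 2 * a * e') / (e - e') with hd
  have hd' : d * (e - e') = -(2 * b + 2 * a * e') := by rw [hd]; field_simp
  clear_value d
  set x := 2 * a - d with hx
  refine ⟨⟨!![x, x * d - 1; 1, d], by rw [Matrix.det_fin_two_of]; ring⟩,
    ⟨!![-(d * e), (x * d - 1) * e'; e, -(x * e')], by
      rw [Matrix.det_fin_two_of]; linear_combination hee⟩, ?_, ?_, ?_, ?_, ?_⟩
  · change (!![x, x * d - 1; 1, d] * !![-(d * e), (x * d - 1) * e'; e, -(x * e')] :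
      Matrix (Fin 2) (Fin 2) ℝ) = _
    ext i j
    fin_cases i <;> fin_cases j <;> simp [Matrix.mul_apply, Fin.sum_univ_two] <;> ring
  · exact one_pos
  · exact he
  · change x + d = _
    rw [hx]; ring
  · change -(d * e) + -(x * e') = _
    rw [hx]; linear_combination -hd'

/-- The four rotations of a hyperbolic quadrilateral. -/
lemma exists_hyperbolic_quadrilateral (a b c d : ℝ) :
    ∃ g₀ g₁ g₂ g₃ : SL(2, ℝ), g₀ * g₁ * g₂ * g₃ = 1 ∧
      0 < g₀ 1 0 ∧ 0 < g₁ 1 0 ∧ 0 < g₂ 1 0 ∧ 0 < g₃ 1 0 ∧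
      g₀ 0 0 + g₀ 1 1 = 2 * a ∧ g₁ 0 0 + g₁ 1 1 = 2 * b ∧
      g₂ 0 0 + g₂ 1 1 = 2 * c ∧ g₃ 0 0 + g₃ 1 1 = 2 * d := by
  -- The two half products are `diag(-2, -1/2)` and `diag(-1/2, -2)`, inverse to each other.
  obtain ⟨g₀, g₁, h, h0, h1, ha, hb⟩ := exists_mul_eq_neg_diag a b (e := 2) (e' := 1 / 2)
    (by norm_num) (by norm_num) (by norm_num)
  obtain ⟨g₂, g₃, h', h2, h3, hc, hd⟩ := exists_mul_eq_neg_diag c d (e := 1 / 2) (e' := 2)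
    (by norm_num) (by norm_num) (by norm_num)
  refine ⟨g₀, g₁, g₂, g₃, ?_, h0, h1, h2, h3, ha, hb, hc, hd⟩
  apply Subtype.ext
  rw [mul_assoc (g₀ * g₁), Matrix.SpecialLinearGroup.coe_mul, h, h']
  ext i j
  fin_cases i <;> fin_cases j <;> simp [Matrix.mul_apply, Fin.sum_univ_two]

/-! ### Euclidean rotations lifted to the Heisenberg group -/

/-- The lift of the translation by `P` to the Heisenberg group acting on `ℂ × ℝ`. -/
noncomputable def heisenbergTranslation (P : ℂ) : Equiv.Perm (ℂ × ℝ) where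
  toFun q := (q.1 + P, q.2 + (conj P * q.1).im)
  invFun q := (q.1 - P, q.2 - (conj P * q.1).im)
  left_inv q := by
    ext1
    · simp
    · simp; ring
  right_inv q := by
    ext1
    · simp
    · simp; ring

/-- The lift of the rotation with centre `P` and multiplier `ζ`. -/
noncomputable def heisenbergRotation (ζ : ℂˣ) (P : ℂ) : Equiv.Perm (ℂ × ℝ) :=
  heisenbergTranslation P * shear ζ (fun _ => 0) * (heisenbergTranslation P)⁻¹

lemma heisenbergRotation_apply (ζ : ℂˣ) (P : ℂ) (q : ℂ × ℝ) :
    heisenbergRotation ζ P q = (ζ * (q.1 - P) + P,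
      q.2 - (conj P * q.1).im + (conj P * (ζ * (q.1 - P))).im) := by
  change ((ζ : ℂ) * (q.1 - P) + P, q.2 - (conj P * q.1).im + 0 + _) = _
  rw [add_zero]
  rfl

lemma heisenbergRotation_pow {ζ : ℂˣ} {k : ℕ} (hζ : ζ ^ k = 1) (P : ℂ) :
    heisenbergRotation ζ P ^ k = 1 := by
  have : shear ζ (fun _ : ℂ => (0 : ℝ)) ^ k = 1 := by
    rw [shear_pow, hζ]
    ext1 q
    simp [shear_apply]
  rw [heisenbergRotation, conj_pow, this]
  group

/-- The product of the rotations of a Euclidean triangle. -/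
lemma heisenbergRotation_mul_three {a b c : ℂˣ} (hb : conj (b : ℂ) * b = 1)
    (hc : conj (c : ℂ) * c = 1) (habc : (a * b * c : ℂ) = 1) {Q : ℂ}
    (hQ : Q * (1 - c) = 1 - conj (b : ℂ)) (q : ℂ × ℝ) :
    (heisenbergRotation a 0 * heisenbergRotation b 1 * heisenbergRotation c Q) q =
      (q.1, q.2 + -(Complex.normSq Q * (c : ℂ).im + (b : ℂ).im)) := by
  obtain ⟨z, r⟩ := q
  have hQ' : conj Q * (1 - conj (c : ℂ)) = 1 - b := by
    have := congrArg conj hQ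
    simpa using this
  simp only [Equiv.Perm.mul_apply, heisenbergRotation_apply, map_zero, map_one, zero_mul, one_mul,
    Complex.zero_im, sub_zero, add_zero]
  ext1
  · simp only
    linear_combination z * habc + a * b * hQ - a * hb
  · simp only
    have hX : -(conj Q * z) + conj Q * (c * (z - Q)) - (c * (z - Q) + Q) +
        b * (c * (z - Q) + Q - 1) = -(conj Q * Q) * c + conj (b : ℂ) - 2 := by
      linear_combination (z * c) * hQ' + z * conj Q * hc + (b - 1) * hQ - hb
    have him := congrArg Complex.im hX
    rw [← Complex.normSq_eq_conj_mul_self, ← Complex.ofReal_neg] at him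
    simp only [Complex.add_im, Complex.sub_im, Complex.neg_im, Complex.im_ofReal_mul,
      Complex.conj_im, Complex.im_ofNat] at him ⊢
    linarith

namespace GenJ

/-- The multiplier `exp (2 i θ)` of a rotation by `2 θ`. -/
noncomputable def rotationUnit (θ : ℝ) : ℂˣ := Units.mk0 (Complex.exp (θ * 2 * Complex.I))
  (Complex.exp_ne_zero _)

lemma coe_rotationUnit (θ : ℝ) : (rotationUnit θ : ℂ) =
    (Real.cos (2 * θ) : ℝ) + (Real.sin (2 * θ) : ℝ) * Complex.I := by
  rw [rotationUnit, Units.val_mk0, Complex.exp_mul_I]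
  push_cast
  rw [mul_comm (θ : ℂ) 2]

lemma rotationUnit_pow {k : ℕ} (hk : k ≠ 0) : rotationUnit (Real.pi / k) ^ k = 1 := by
  ext
  rw [Units.val_pow_eq_pow_val, rotationUnit, Units.val_mk0, ← Complex.exp_nat_mul, Units.val_one,
    ← Complex.exp_two_pi_mul_I]
  congr 1
  have : (k : ℂ) ≠ 0 := by exact_mod_cast hk
  push_cast
  field_simp

lemma conj_rotationUnit_mul_self (θ : ℝ) :
    conj (rotationUnit θ : ℂ) * rotationUnit θ = 1 := by
  rw [← Complex.normSq_eq_conj_mul_self, coe_rotationUnit, Complex.normSq_add_mul_I,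
    Real.cos_sq_add_sin_sq, Complex.ofReal_one]

/-- The area of a Euclidean triangle is nonzero. -/
lemma triangle_shift_ne_zero {α β γ : ℝ} (hα : 0 < α) (hβ : 0 < β) (hγ : 0 < γ)
    (hsum : α + β + γ = Real.pi) {Q : ℂ}
    (hQ : Q * (1 - rotationUnit γ) = 1 - conj (rotationUnit β : ℂ)) :
    -(Complex.normSq Q * (rotationUnit γ : ℂ).im + (rotationUnit β : ℂ).im) ≠ 0 := by
  have hπ := Real.pi_pos
  have hsα : 0 < Real.sin (β + γ) := Real.sin_pos_of_pos_of_lt_pi (by linarith) (by linarith)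
  have hsβ : 0 < Real.sin β := Real.sin_pos_of_pos_of_lt_pi hβ (by linarith)
  have hsγ : 0 < Real.sin γ := Real.sin_pos_of_pos_of_lt_pi hγ (by linarith)
  -- Norms give `|Q|² sin² γ = sin² β`, which turns the shift into a nonzero multiple of `sin (β +
  -- γ)`.
  have hn := congrArg Complex.normSq hQ
  have hns : ∀ θ : ℝ, Complex.normSq (1 - (rotationUnit θ : ℂ)) = 4 * Real.sin θ ^ 2 := by
    intro θ
    rw [coe_rotationUnit, Complex.normSq_apply]
    simp only [Complex.sub_re, Complex.one_re, Complex.add_re, Complex.ofReal_re, Complex.mul_re,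
      Complex.I_re, mul_zero, Complex.ofReal_im, Complex.I_im, mul_one, sub_self, add_zero,
      Complex.sub_im, Complex.one_im, Complex.add_im, Complex.mul_im, zero_add]
    rw [Real.cos_two_mul, Real.sin_two_mul]
    linear_combination (4 * (Real.cos θ ^ 2 - 1)) * Real.sin_sq_add_cos_sq θ
  have hconj : (1 - conj (rotationUnit β : ℂ)) = conj (1 - (rotationUnit β : ℂ)) := by simp
  rw [Complex.normSq_mul, hns, hconj, Complex.normSq_conj, hns] at hn
  have him : ∀ θ, (rotationUnit θ : ℂ).im = 2 * Real.sin θ * Real.cos θ := by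
    intro θ
    rw [coe_rotationUnit, ← Real.sin_two_mul]
    simp [-Complex.ofReal_cos, -Complex.ofReal_sin]
  rw [him, him]
  intro h0
  rw [Real.sin_add] at hsα
  have : 8 * (Real.sin β * Real.sin γ) *
      (Real.sin β * Real.cos γ + Real.cos β * Real.sin γ) = 0 := by
    linear_combination (-4 * Real.sin γ ^ 2) * h0 - (2 * Real.sin γ * Real.cos γ) * hn
  have hne := mul_pos (mul_pos (by norm_num : (0 : ℝ) < 8) (mul_pos hsβ hsγ)) hsα
  linarith

/-- The product of the point reflections in the vertices of a square. -/
lemma heisenbergRotation_square (q : ℂ × ℝ) :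
    (heisenbergRotation (-1) 0 * heisenbergRotation (-1) 1 *
      heisenbergRotation (-1) (1 + Complex.I) * heisenbergRotation (-1) Complex.I) q =
      (q.1, q.2 + -4) := by
  simp only [Equiv.Perm.mul_apply, heisenbergRotation_apply]
  ext1
  · simp; ring
  · simp; ring

/-! ### Infinite order of the central element -/

variable {p : ℕ} (K : Fin p → ℕ∞)

/-- A criterion for the central element of `J(K)` to have infinite order. -/
lemma not_isOfFinOrder_coxElt_of_perm {X : Type*} [Nonempty X]
    (f : Fin p → Equiv.Perm (X × ℝ)) (hk : ∀ i (k : ℕ), K i = k → f i ^ k = 1) {δ : ℝ}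
    (hδ : δ ≠ 0) (hf : ∀ q, (List.ofFn f).prod q = (q.1, q.2 + δ))
    (hcomm : ∀ i q, f i (q.1, q.2 + δ) = ((f i q).1, (f i q).2 + δ)) :
    ¬ IsOfFinOrder (coxElt K) := by
  have hc : ∀ i, Commute (List.ofFn f).prod (f i) := by
    intro i
    ext1 q
    rw [Equiv.Perm.mul_apply, Equiv.Perm.mul_apply, hf, hf, hcomm]
  intro h
  have h2 := MonoidHom.isOfFinOrder (lift K f hc hk) h
  rw [lift_coxElt] at h2
  exact not_isOfFinOrder_of_translation hf hδ h2

lemma moebiusLift_add (g : SL(2, ℝ)) (θ δ : ℝ) (q : ℍ × ℝ) :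
    moebiusLift g θ (q.1, q.2 + δ) = ((moebiusLift g θ q).1, (moebiusLift g θ q).2 + δ) := by
  simp only [moebiusLift, shear_apply]
  ext1
  · rfl
  · simp only; ring

lemma heisenbergRotation_add (ζ : ℂˣ) (P : ℂ) (δ : ℝ) (q : ℂ × ℝ) :
    heisenbergRotation ζ P (q.1, q.2 + δ) =
      ((heisenbergRotation ζ P q).1, (heisenbergRotation ζ P q).2 + δ) := by
  simp only [heisenbergRotation_apply]
  ext1
  · rfl
  · simp only; ring

/-- The central element has infinite order if some exponent is infinite. -/
lemma not_isOfFinOrder_coxElt_of_top {i : Fin p} (hi : K i = ⊤) :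
    ¬ IsOfFinOrder (coxElt K) := by
  let f : Fin p → Multiplicative ℤ := fun j => if j = i then Multiplicative.ofAdd 1 else 1
  have hk : ∀ j (k : ℕ), K j = k → f j ^ k = 1 := by
    intro j k hj
    have hji : j ≠ i := by
      rintro rfl
      rw [hi] at hj
      exact ENat.top_ne_natCast k hj
    simp [f, hji]
  intro h
  have h2 := MonoidHom.isOfFinOrder (lift K f (fun j => Commute.all _ _) hk) h
  have hprod : (List.ofFn f).prod = Multiplicative.ofAdd 1 := by
    rw [List.prod_ofFn, Finset.prod_ite_eq' Finset.univ i]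
    simp
  rw [lift_coxElt, hprod] at h2
  obtain ⟨n, hn, hpow⟩ := isOfFinOrder_iff_pow_eq_one.mp h2
  rw [← ofAdd_nsmul, ofAdd_eq_one] at hpow
  simp at hpow
  omega

/-- The central element has infinite order for Euclidean and hyperbolic triangles. -/
lemma not_isOfFinOrder_coxElt_triangle (K : Fin 3 → ℕ∞) (hK : ∀ i, 2 ≤ K i) (k : Fin 3 → ℕ)
    (hk : ∀ i, K i = k i) (hsum : Real.pi / k 0 + Real.pi / k 1 + Real.pi / k 2 ≤ Real.pi) :
    ¬ IsOfFinOrder (coxElt K) := by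
  have hk2 : ∀ i, 2 ≤ k i := fun i => by
    have := hK i
    rw [hk] at this
    exact_mod_cast this
  have hkeq : ∀ i (m : ℕ), K i = m → m = k i := fun i m h => by
    rw [hk] at h
    exact_mod_cast h.symm
  have hθ := fun i => pi_div_mem (hk2 i)
  -- In the hyperbolic case the central element translates by the angle defect. This vanishes in the
  -- Euclidean case, where the Heisenberg action is used instead.
  rcases hsum.lt_or_eq with hlt | heq
  · obtain ⟨g₀, g₁, g₂, hprod, h0, h1, h2, t0, t1, t2⟩ := exists_hyperbolic_triangle (hθ 0).1
      (hθ 0).2 (hθ 1).1 (hθ 1).2 (hθ 2).1 hlt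
    refine not_isOfFinOrder_coxElt_of_perm K
      ![moebiusLift g₀ (Real.pi / k 0), moebiusLift g₁ (Real.pi / k 1),
        moebiusLift g₂ (Real.pi / k 2)] ?_
      (δ := Real.pi - (Real.pi / k 0 + Real.pi / k 1 + Real.pi / k 2)) (by linarith) ?_ ?_
    · intro i m hm
      rw [hkeq i m hm]
      fin_cases i
      exacts [moebiusLift_pow h0 (hk2 0) t0, moebiusLift_pow h1 (hk2 1) t1,
        moebiusLift_pow h2 (hk2 2) t2]
    · intro q
      rw [← moebiusLift_mul_three h0 h1 h2 hprod]
      simp [List.ofFn_succ, mul_assoc]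
    · intro i q
      fin_cases i <;> exact moebiusLift_add _ _ _ _
  · have hc1 : 1 - (rotationUnit (Real.pi / k 2) : ℂ) ≠ 0 := by
      intro h
      have him := congrArg Complex.re h
      rw [coe_rotationUnit, Real.cos_two_mul'] at him
      simp only [Complex.sub_re, Complex.one_re, Complex.add_re, Complex.ofReal_re, Complex.mul_re,
        Complex.I_re, mul_zero, Complex.ofReal_im, Complex.I_im, mul_one, sub_self, add_zero,
        Complex.zero_re] at him
      have := sin_pi_div_pos (hk2 2)
      nlinarith [Real.sin_sq_add_cos_sq (Real.pi / k 2)]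
    set Q : ℂ := (1 - conj (rotationUnit (Real.pi / k 1) : ℂ)) /
      (1 - (rotationUnit (Real.pi / k 2) : ℂ)) with hQdef
    have hQ : Q * (1 - rotationUnit (Real.pi / k 2)) =
        1 - conj (rotationUnit (Real.pi / k 1) : ℂ) := div_mul_cancel₀ _ hc1
    have habc : (rotationUnit (Real.pi / k 0) * rotationUnit (Real.pi / k 1) *
        rotationUnit (Real.pi / k 2) : ℂ) = 1 := by
      simp only [rotationUnit, Units.val_mk0]
      rw [← Complex.exp_add, ← Complex.exp_add, ← Complex.exp_two_pi_mul_I]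
      congr 1
      have : ((Real.pi / k 0 : ℝ) + (Real.pi / k 1 : ℝ) + (Real.pi / k 2 : ℝ) : ℂ) =
          (Real.pi : ℝ) := by exact_mod_cast heq
      linear_combination 2 * Complex.I * this
    refine not_isOfFinOrder_coxElt_of_perm K
      ![heisenbergRotation (rotationUnit (Real.pi / k 0)) 0,
        heisenbergRotation (rotationUnit (Real.pi / k 1)) 1,
        heisenbergRotation (rotationUnit (Real.pi / k 2)) Q] ?_
      (triangle_shift_ne_zero (hθ 0).1 (hθ 1).1 (hθ 2).1 heq hQ) ?_ ?_
    · intro i m hm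
      rw [hkeq i m hm]
      have hne : ∀ i, k i ≠ 0 := fun i => by have := hk2 i; omega
      fin_cases i <;> exact heisenbergRotation_pow (rotationUnit_pow (hne _)) _
    · intro q
      rw [← heisenbergRotation_mul_three (conj_rotationUnit_mul_self _)
        (conj_rotationUnit_mul_self _) habc hQ]
      simp [List.ofFn_succ, mul_assoc]
    · intro i q
      fin_cases i <;> exact heisenbergRotation_add _ _ _ _

/-- The central element has infinite order for polygons with at least four sides. -/
lemma not_isOfFinOrder_coxElt_polygon {n : ℕ} (K : Fin (n + 4) → ℕ∞) (hK : ∀ i, 2 ≤ K i) :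
    ¬ IsOfFinOrder (coxElt K) := by
  by_cases htop : ∃ i, K i = ⊤
  · obtain ⟨i, hi⟩ := htop
    exact not_isOfFinOrder_coxElt_of_top K hi
  push Not at htop
  choose k hk using fun i => ENat.ne_top_iff_exists.mp (htop i)
  have hk2 : ∀ i, 2 ≤ k i := fun i => by
    have := hK i
    rw [← hk] at this
    exact_mod_cast this
  have hkeq : ∀ i (m : ℕ), K i = m → m = k i := fun i m h => by
    rw [← hk] at h
    exact_mod_cast h.symm
  have hθ := fun i => pi_div_mem (hk2 i)
  have main : ∀ {X : Type} [Nonempty X] (f : Fin 4 → Equiv.Perm (X × ℝ)) (δ : ℝ), δ ≠ 0 →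
      (∀ i : Fin 4, f i ^ k (Fin.castLE (by omega) i) = 1) →
      (∀ q, (f 0 * f 1 * f 2 * f 3) q = (q.1, q.2 + δ)) →
      (∀ i q, f i (q.1, q.2 + δ) = ((f i q).1, (f i q).2 + δ)) → ¬ IsOfFinOrder (coxElt K) := by
    intro X _ f δ hδ hpow hprod hcomm
    -- Only the first four generators act; sending the others to `1` respects all the relations.
    let F : Fin (n + 4) → Equiv.Perm (X × ℝ) := fun i =>
      if h : (i : ℕ) < 4 then f ⟨i, h⟩ else 1
    refine not_isOfFinOrder_coxElt_of_perm K F ?_ hδ ?_ ?_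
    · intro i m hm
      rw [hkeq i m hm]
      simp only [F]
      split_ifs with h
      · exact hpow ⟨i, h⟩
      · exact one_pow _
    · intro q
      rw [← hprod]
      have hrest : (List.ofFn fun i : Fin n => F i.succ.succ.succ.succ).prod = 1 := by
        apply List.prod_eq_one
        intro x hx
        obtain ⟨i, rfl⟩ := List.mem_ofFn.mp hx
        simp [F]
      have h0 : F 0 = f 0 := by simp [F]
      have h1 : F (Fin.succ 0) = f 1 := by simp [F]
      have h2 : F (Fin.succ (Fin.succ 0)) = f 2 := by
        simp only [F, Fin.val_succ, Fin.val_zero]; rfl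
      have h3 : F (Fin.succ (Fin.succ (Fin.succ 0))) = f 3 := by
        simp only [F, Fin.val_succ, Fin.val_zero]; rfl
      rw [List.ofFn_succ, List.ofFn_succ, List.ofFn_succ, List.ofFn_succ]
      simp only [List.prod_cons, hrest, h0, h1, h2, h3, mul_one, mul_assoc]
    · intro i q
      simp only [F]
      split_ifs with h
      · exact hcomm _ _
      · rfl
  set c : Fin 4 → Fin (n + 4) := Fin.castLE (by omega) with hc
  -- Four right angles leave no hyperbolic angle defect, so the Euclidean square takes over.
  by_cases hall : ∀ i, k (c i) = 2
  · refine main ![heisenbergRotation (-1) 0, heisenbergRotation (-1) 1,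
      heisenbergRotation (-1) (1 + Complex.I), heisenbergRotation (-1) Complex.I] (-4)
      (by norm_num) ?_ heisenbergRotation_square ?_
    · intro i
      rw [hall i]
      fin_cases i <;> exact heisenbergRotation_pow (by simp) _
    · intro i q
      fin_cases i <;> exact heisenbergRotation_add _ _ _ _
  · push Not at hall
    obtain ⟨j, hj⟩ := hall
    have hjlt : Real.pi / k (c j) < Real.pi / 2 := by
      apply div_lt_div_of_pos_left Real.pi_pos (by norm_num)
      have : 2 < k (c j) := lt_of_le_of_ne (hk2 _) hj.symm
      exact_mod_cast this
    have hδ : 2 * Real.pi - (Real.pi / k (c 0) + Real.pi / k (c 1) + Real.pi / k (c 2) +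
        Real.pi / k (c 3)) ≠ 0 := by
      have b0 := (hθ (c 0)).2
      have b1 := (hθ (c 1)).2
      have b2 := (hθ (c 2)).2
      have b3 := (hθ (c 3)).2
      apply ne_of_gt
      fin_cases j <;> simp only [Fin.zero_eta, Fin.mk_one, Fin.reduceFinMk] at hjlt <;> linarith
    obtain ⟨g₀, g₁, g₂, g₃, hprod, h0, h1, h2, h3, t0, t1, t2, t3⟩ :=
      exists_hyperbolic_quadrilateral (Real.cos (Real.pi / k (c 0)))
        (Real.cos (Real.pi / k (c 1))) (Real.cos (Real.pi / k (c 2)))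
        (Real.cos (Real.pi / k (c 3)))
    refine main ![moebiusLift g₀ (Real.pi / k (c 0)), moebiusLift g₁ (Real.pi / k (c 1)),
      moebiusLift g₂ (Real.pi / k (c 2)), moebiusLift g₃ (Real.pi / k (c 3))] _ hδ ?_
      (moebiusLift_mul_four h0 h1 h2 h3 hprod _ _ _ _) ?_
    · intro i
      fin_cases i
      exacts [moebiusLift_pow h0 (hk2 _) t0, moebiusLift_pow h1 (hk2 _) t1,
        moebiusLift_pow h2 (hk2 _) t2, moebiusLift_pow h3 (hk2 _) t3]
    · intro i q
      fin_cases i <;> exact moebiusLift_add _ _ _ _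

end GenJ

/-! ### Torsion of `J(K)` and of the generalized J-group -/

namespace GenJ

lemma isOfFinOrder_gen {p : ℕ} {K : Fin p → ℕ∞} {i : Fin p} (h : 2 ≤ K i) (hi : K i ≠ ⊤) :
    IsOfFinOrder (gen K i) := by
  obtain ⟨k, hk⟩ := ENat.ne_top_iff_exists.mp hi
  rw [← hk] at h
  have h2 : 2 ≤ k := by exact_mod_cast h
  exact isOfFinOrder_iff_pow_eq_one.mpr ⟨k, by omega, gen_pow K hk.symm⟩

/-- The torsion of `J(K)` when its central element has infinite order. -/
theorem exists_conj_gen_zpow_of_polygon {n : ℕ} (K : Fin (n + 3) → ℕ∞) (hK : ∀ i, 2 ≤ K i)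
    [Infinite (PolygonReflectionGroup K hK)] (hc : ¬ IsOfFinOrder (coxElt K)) {x : ParentJ K}
    (hx : IsOfFinOrder x) :
    ∃ (g : ParentJ K) (i : Fin (n + 3)) (m : ℤ), x = g * gen K i ^ m * g⁻¹ := by
  have hzpow : ∀ m : ℤ, IsOfFinOrder (coxElt K ^ m) → m = 0 := by
    intro m hm
    by_contra hm0
    have h : IsOfFinOrder (coxElt K ^ m.natAbs) := by
      rcases Int.natAbs_eq m with h | h <;> rw [h] at hm
      · rwa [zpow_natCast] at hm
      · rwa [zpow_neg, zpow_natCast, isOfFinOrder_inv_iff] at hm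
    exact (isOfFinOrder_pow.mp h).elim hc (by simpa using hm0)
  rcases polygonGroup_torsion K hK
    (MonoidHom.isOfFinOrder (QuotientGroup.mk' (Subgroup.zpowers (coxElt K))) hx) with
    h1 | ⟨g, i, m, hi, h⟩
  · obtain ⟨l, rfl⟩ := (QuotientGroup.eq_one_iff x).mp h1
    have : l = 0 := hzpow l hx
    exact ⟨1, 0, 0, by simp [this]⟩
  · obtain ⟨g, rfl⟩ := QuotientGroup.mk_surjective g
    have h2 : (QuotientGroup.mk x : PolygonGroup K) =
        QuotientGroup.mk (g * gen K i ^ m * g⁻¹) := h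
    obtain ⟨l, hl⟩ := QuotientGroup.eq.mp h2.symm
    simp only at hl
    have hxl : x = (g * gen K i ^ m * g⁻¹) * coxElt K ^ l := by rw [hl]; group
    have hcen : ∀ y, Commute y (coxElt K ^ l) := fun y =>
      (Commute.zpow_right (Subgroup.mem_center_iff.mp (coxElt_mem_center K) y) l)
    have hfin : IsOfFinOrder (gen K i) := isOfFinOrder_gen (hK i) hi
    have hfin' : IsOfFinOrder (g * gen K i ^ m * g⁻¹) := by
      have := MonoidHom.isOfFinOrder (MulAut.conj g).toMonoidHom (hfin.zpow (i := m))
      simpa using this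
    have hcl : coxElt K ^ l = (g * gen K i ^ m * g⁻¹)⁻¹ * x := by rw [hxl]; group
    -- The central `c ^ l` is the product of two commuting torsion elements, so it is torsion.
    have hl0 : l = 0 := by
      apply hzpow
      rw [hcl]
      refine Commute.isOfFinOrder_mul ?_ hfin'.inv hx
      rw [hxl]
      exact Commute.mul_right (Commute.refl _).inv_left (hcen _)
    exact ⟨g, i, m, by rw [hxl, hl0, zpow_zero, mul_one]⟩

section Character

variable {p : ℕ} (K : Fin p → ℕ∞)

/-- The character of `J(K)` with values in `ℤ/n` counting the occurrences of the `i`-th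
generator. -/
def countHom (i : Fin p) (n : ℕ) (h : ∀ k : ℕ, K i = k → n ∣ k) :
    ParentJ K →* Multiplicative (ZMod n) :=
  lift K (fun j => if j = i then Multiplicative.ofAdd 1 else 1) (fun _ => Commute.all _ _) (by
    intro j k hk
    by_cases hj : j = i
    · subst hj
      rw [if_pos rfl, ← ofAdd_nsmul, nsmul_one, (ZMod.natCast_eq_zero_iff k n).mpr (h k hk),
        ofAdd_zero]
    · rw [if_neg hj, one_pow])

lemma countHom_gen_self (i : Fin p) (n : ℕ) (h : ∀ k : ℕ, K i = k → n ∣ k) :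
    countHom K i n h (gen K i) = Multiplicative.ofAdd 1 := by
  simp [countHom]

lemma countHom_gen_of_ne {i j : Fin p} (hij : j ≠ i) (n : ℕ) (h : ∀ k : ℕ, K i = k → n ∣ k) :
    countHom K i n h (gen K j) = 1 := by
  simp [countHom, hij]

lemma countHom_gen_zpow_eq_one_iff (i : Fin p) (n : ℕ) (h : ∀ k : ℕ, K i = k → n ∣ k) (m : ℤ) :
    countHom K i n h (gen K i ^ m) = 1 ↔ (n : ℤ) ∣ m := by
  rw [map_zpow, countHom_gen_self, ← ofAdd_zsmul, zsmul_one, ofAdd_eq_one,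
    ZMod.intCast_zmod_eq_zero_iff_dvd]

end Character

lemma exists_eq_gen_zpow_one (K : Fin 1 → ℕ∞) (x : ParentJ K) : ∃ m : ℤ, x = gen K 0 ^ m := by
  have hx : x ∈ Subgroup.closure (Set.range (gen K)) := by
    rw [closure_range_gen]; exact Subgroup.mem_top x
  rw [Set.range_unique, Subgroup.mem_closure_singleton] at hx
  obtain ⟨m, hm⟩ := hx
  exact ⟨m, hm.symm⟩

lemma commute_gen_two (K : Fin 2 → ℕ∞) : Commute (gen K 0) (gen K 1) := by
  have h := coxElt_commute_gen K 0
  have hc : coxElt K = gen K 0 * gen K 1 := by simp [coxElt, List.ofFn_succ]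
  rw [hc, commute_iff_eq, mul_assoc] at h
  exact (mul_left_cancel h).symm

lemma exists_eq_gen_zpow_two (K : Fin 2 → ℕ∞) (x : ParentJ K) :
    ∃ a b : ℤ, x = gen K 0 ^ a * gen K 1 ^ b := by
  have hx : x ∈ Subgroup.closure (Set.range (gen K)) := by
    rw [closure_range_gen]; exact Subgroup.mem_top x
  have hcomm := fun m n : ℤ => ((commute_gen_two K).zpow_zpow m n).eq
  induction hx using Subgroup.closure_induction with
  | mem y hy =>
    obtain ⟨i, rfl⟩ := hy
    fin_cases i
    · exact ⟨1, 0, by simp⟩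
    · exact ⟨0, 1, by simp⟩
  | one => exact ⟨0, 0, by simp⟩
  | mul y z _ _ hy hz =>
    obtain ⟨a, b, rfl⟩ := hy
    obtain ⟨c, d, rfl⟩ := hz
    refine ⟨a + c, b + d, ?_⟩
    rw [zpow_add, zpow_add, mul_assoc, ← mul_assoc (gen K 1 ^ b), ← hcomm]
    simp only [mul_assoc]
  | inv y _ hy =>
    obtain ⟨a, b, rfl⟩ := hy
    refine ⟨-a, -b, ?_⟩
    rw [mul_inv_rev, ← zpow_neg, ← zpow_neg, hcomm]

/-- When `k_i = ∞`, the count of `s_i` may be taken in `ZMod 0 = ℤ`, which is torsion-free. -/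
lemma exponent_eq_zero_of_isOfFinOrder {p : ℕ} (K : Fin p → ℕ∞) {i j : Fin p} (hij : j ≠ i)
    (hi : K i = ⊤) {a b : ℤ} (hx : IsOfFinOrder (gen K i ^ a * gen K j ^ b)) : a = 0 := by
  obtain ⟨n, hn, h⟩ := isOfFinOrder_iff_pow_eq_one.mp hx
  have h0 : ∀ k : ℕ, K i = k → 0 ∣ k := fun k hk => by simp [hi] at hk
  have h1 := congrArg (countHom K i 0 h0) h
  rw [map_pow, map_mul, map_zpow _ (gen K j), countHom_gen_of_ne K hij, one_zpow, mul_one,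
    ← map_pow, map_one, ← zpow_natCast, ← zpow_mul, countHom_gen_zpow_eq_one_iff] at h1
  rw [Nat.cast_zero, zero_dvd_iff] at h1
  rcases mul_eq_zero.mp h1 with h | h
  · exact h
  · omega

lemma exists_conj_gen_zpow_two (K : Fin 2 → ℕ∞) (hK : ∀ i, 2 ≤ K i)
    [hinf : Infinite (ParentJ K)] {x : ParentJ K} (hx : IsOfFinOrder x) :
    ∃ (g : ParentJ K) (i : Fin 2) (m : ℤ), x = g * gen K i ^ m * g⁻¹ := by
  obtain ⟨a, b, rfl⟩ := exists_eq_gen_zpow_two K x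
  by_cases h0 : K 0 = ⊤
  · have := exponent_eq_zero_of_isOfFinOrder K (by decide) h0 hx
    exact ⟨1, 1, b, by simp [this]⟩
  by_cases h1 : K 1 = ⊤
  · rw [((commute_gen_two K).zpow_zpow a b).eq] at hx
    have := exponent_eq_zero_of_isOfFinOrder K (by decide) h1 hx
    exact ⟨1, 0, a, by simp [this]⟩
  exfalso
  have : Finite (Subgroup.zpowers (gen K 0)) := (isOfFinOrder_gen (hK 0) h0).finite_zpowers
  have : Finite (Subgroup.zpowers (gen K 1)) := (isOfFinOrder_gen (hK 1) h1).finite_zpowers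
  refine not_finite_iff_infinite.mpr hinf (Finite.of_surjective
    (fun q : Subgroup.zpowers (gen K 0) × Subgroup.zpowers (gen K 1) =>
      (q.1 : ParentJ K) * (q.2 : ParentJ K)) fun y => ?_)
  obtain ⟨a, b, rfl⟩ := exists_eq_gen_zpow_two K y
  exact ⟨(⟨_, a, rfl⟩, ⟨_, b, rfl⟩), rfl⟩

lemma infinite_reflectionGroup {n : ℕ} (K : Fin (n + 3) → ℕ∞) (hK : ∀ i, 2 ≤ K i)
    {i j : Fin (n + 3)} (hij : i ≠ j) (h : polygonMatrix K hK i j = 0) :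
    Infinite (PolygonReflectionGroup K hK) := by
  rw [← not_finite_iff_infinite]
  intro hfin
  exact (polygonSystem K hK).not_isOfFinOrder_simple_mul_simple hij h (isOfFinOrder_of_finite _)

lemma infinite_reflectionGroup_of_infinite {n : ℕ} (K : Fin (n + 3) → ℕ∞) (hK : ∀ i, 2 ≤ K i)
    (hfin : ∀ i, K i ≠ ⊤) [hinf : Infinite (ParentJ K)] :
    Infinite (PolygonReflectionGroup K hK) := by
  rw [← not_finite_iff_infinite]
  intro hW
  have : Finite (PolygonGroup K) := Finite.of_injective _ (toReflectionGroup_injective K hK)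
  have hK0 : ∀ i, K i ≠ 0 := fun i h => by simpa [h] using hK i
  exact not_finite_iff_infinite.mpr hinf (finite_of_finite_polygonGroup K hfin hK0)

/-- In an infinite group `J(K)` every element of finite order is conjugate to a power of a
generator. -/
theorem exists_conj_gen_zpow {p : ℕ} (hp : 0 < p) (K : Fin p → ℕ∞) (hK : ∀ i, 2 ≤ K i)
    [hinf : Infinite (ParentJ K)] {x : ParentJ K} (hx : IsOfFinOrder x) :
    ∃ (g : ParentJ K) (i : Fin p) (m : ℤ), x = g * gen K i ^ m * g⁻¹ := by
  match p, hp, K, hK, hinf, x, hx with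
  | 1, _, K, _, _, x, _ =>
    obtain ⟨m, rfl⟩ := exists_eq_gen_zpow_one K x
    exact ⟨1, 0, m, by simp⟩
  | 2, _, K, hK, _, x, hx => exact exists_conj_gen_zpow_two K hK hx
  | n + 3, _, K, hK, hinf, x, hx =>
    by_cases htop : ∃ i, K i = ⊤
    · obtain ⟨i, hi⟩ := htop
      have := infinite_reflectionGroup K hK (fin_add_one_ne_self i).symm
        (by rw [polygonMatrix_succ, hi, ENat.toNat_top])
      exact exists_conj_gen_zpow_of_polygon K hK (not_isOfFinOrder_coxElt_of_top K hi) hx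
    push Not at htop
    have hW := infinite_reflectionGroup_of_infinite K hK htop
    refine exists_conj_gen_zpow_of_polygon K hK ?_ hx
    match n, K, hK, hW, htop with
    | 0, K, hK, hW, htop =>
      choose k hk using fun i => ENat.ne_top_iff_exists.mp (htop i)
      refine not_isOfFinOrder_coxElt_triangle K hK k (fun i => (hk i).symm) ?_
      by_contra hsum
      exact not_finite_iff_infinite.mpr hW (finite_reflectionGroup_of_spherical K hK k
        (fun i => (hk i).symm) (not_le.mp hsum))
    | n + 1, K, hK, _, _ => exact not_isOfFinOrder_coxElt_polygon K hK

lemma mem_generalizedJ_of_mem_reflections {p : ℕ} {K : Fin p → ℕ∞} {K' : Fin p → ℕ}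
    {x : ParentJ K} (hx : x ∈ reflections K K') : x ∈ generalizedJ K K' ∧ x ≠ 1 := by
  obtain ⟨g, i, n, hn, rfl⟩ := hx
  have hmem : gen K i ^ K' i ∈ generalizedJ K K' := Subgroup.subset_normalClosure ⟨i, rfl⟩
  exact ⟨Subgroup.normalClosure_normal.conj_mem _ (zpow_mem hmem n) g,
    fun h => hn (conj_eq_one_iff.mp h)⟩

/-- The count of `s_i` modulo `k'_i` is trivial on every `s_j ^ k'_j`, hence on their normal
closure. -/
lemma dvd_of_gen_zpow_mem {p : ℕ} (K : Fin p → ℕ∞) (K' : Fin p → ℕ) {i : Fin p}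
    (hdvd : ∀ k : ℕ, K i = k → K' i ∣ k) {m : ℤ} (h : gen K i ^ m ∈ generalizedJ K K') :
    (K' i : ℤ) ∣ m := by
  rw [← countHom_gen_zpow_eq_one_iff K i (K' i) hdvd, ← MonoidHom.mem_ker]
  refine Subgroup.normalClosure_le_normal ?_ h
  rintro _ ⟨j, rfl⟩
  rw [SetLike.mem_coe, MonoidHom.mem_ker]
  change countHom K i (K' i) hdvd (gen K j ^ K' j) = 1
  by_cases hj : j = i
  · subst hj
    rw [← zpow_natCast, countHom_gen_zpow_eq_one_iff]
  · rw [map_pow, countHom_gen_of_ne K hj, one_pow]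

end GenJ

/-- Divisibility in `ℕ∞` is the ordinary one between natural numbers, and every nonzero natural
number divides `⊤ = ∞`. The identity is not a reflection, so it is left out of the torsion
elements. -/
theorem corollary3p23 {p : ℕ} (hp : 0 < p) (K : Fin p → ℕ∞) (hK : ∀ i, 2 ≤ K i)
    (K' : Fin p → ℕ) (hK' : ∀ i, 1 ≤ K' i) (hdvd : ∀ i, (K' i : ℕ∞) ∣ K i)
    (hinf : Infinite (GenJ.generalizedJ K K')) :
    {x : GenJ.ParentJ K | x ∈ GenJ.generalizedJ K K' ∧ x ≠ 1 ∧ IsOfFinOrder x} =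
      {x : GenJ.ParentJ K | x ∈ GenJ.reflections K K' ∧ IsOfFinOrder x} := by
  have : Infinite (GenJ.ParentJ K) :=
    Infinite.of_injective (Subtype.val : GenJ.generalizedJ K K' → _) Subtype.val_injective
  ext x
  refine ⟨fun ⟨hx, hx1, hfin⟩ => ⟨?_, hfin⟩, fun ⟨hx, hfin⟩ =>
    ⟨(GenJ.mem_generalizedJ_of_mem_reflections hx).1,
      (GenJ.mem_generalizedJ_of_mem_reflections hx).2, hfin⟩⟩
  obtain ⟨g, i, m, rfl⟩ := GenJ.exists_conj_gen_zpow hp K hK hfin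
  have hmem : GenJ.gen K i ^ m ∈ GenJ.generalizedJ K K' := by
    have h := Subgroup.normalClosure_normal.conj_mem _ hx g⁻¹
    rwa [inv_inv, show g⁻¹ * (g * GenJ.gen K i ^ m * g⁻¹) * g = GenJ.gen K i ^ m by group] at h
  have hk : ∀ k : ℕ, K i = k → K' i ∣ k := by
    intro k hk
    have h := hdvd i
    rw [hk] at h
    obtain ⟨c, hc⟩ := h
    -- Since `k'_i ≥ 1`, a cofactor `∞` would make the finite `k` infinite.
    have hc' : c ≠ ⊤ := by
      rintro rfl
      rw [ENat.mul_top (by have := hK' i; simp; omega)] at hc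
      simp at hc
    obtain ⟨d, rfl⟩ := ENat.ne_top_iff_exists.mp hc'
    exact ⟨d, by exact_mod_cast hc⟩
  obtain ⟨q, rfl⟩ := GenJ.dvd_of_gen_zpow_mem K K' hk hmem
  refine ⟨g, i, q, ?_, by rw [zpow_mul, zpow_natCast]⟩
  rw [← zpow_natCast, ← zpow_mul]
  exact fun h => hx1 (by rw [h, mul_one, mul_inv_cancel])
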